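/- Let $\langle x,y\rangle=-x_0y_0+x_1y_1+x_2y_2$ on $\mathbb R^3$, and let $\mathbb H^2=\{p\in\mathbb R^3:\langle p,p\rangle=-1,\ p_0>0\}$ be the hyperbolic plane with the Riemannian metric induced by $\langle\cdot,\cdot\rangle$, Levi-Civita connection $\nabla$, and complex structure $J_p v=p\boxtimes v$ on $T_p\mathbb H^2$, where $x\boxtimes y$ is the vector with $\langle x\boxtimes y,v\rangle=\det(x,y,v)$ for all $v$. Write $\Delta u$ for the trace of the hyperbolic Hessian $Y\mapsto\nabla_Y\operatorname{grad}u$. Let $\Pi(p)=(p_1/p_0,\,p_2/p_0)$ be the radial projection of $\mathbb H^2$ onto the open unit disk $\mathbb D^2\subset\mathbb R^2\cong\mathbb C$, and for $u:\mathbb H^2\to\mathbb R$ put $\overline u(\eta)=\sqrt{1-|\eta|^2}\,u(\Pi^{-1}(\eta))$, $\eta\in\mathbb D^2$. Let $X$ be a continuous (tangent) vector field on the unit circle $\mathbb S^1$, and let $\phi_X:\mathbb S^1\to\mathbb R$ be its support function, given by $X(z)=iz\,\phi_X(z)$. For $\eta\in\mathbb D^2$ let $$\phi_X^-(\eta)=\sup\{a(\eta):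 a:\mathbb R^2\to\mathbb R\text{ affine},\ a|_{\mathbb S^1}\le\phi_X\},\qquad \phi_X^+(\eta)=\inf\{a(\eta): a:\mathbb R^2\to\mathbb R\text{ affine},\ a|_{\mathbb S^1}\ge\phi_X\}$$ (their graphs bound the convex hull of the graph of $\phi_X$ from below and from above), and define the local width $$w_X(\eta)=\frac{\phi_X^+(\eta)-\phi_X^-(\eta)}{\sqrt{1-|\eta|^2}}.$$ Then there is a unique smooth function $u_X:\mathbb H^2\to\mathbb R$ such that $\Delta u_X-2u_X=0$ and $\overline{u_X}$ extends continuously to $\mathbb S^1$ by $\phi_X$. Put $\mathrm{HL}(X)=J\operatorname{grad}u_X$. For a smooth vector field $V$ on $\mathbb H^2$ let $\overline\partial V(Y)=\tfrac12(\nabla_YV+J\nabla_{JY}V)$, and let $\|\overline\partial V_p\|$ be the operator norm of $\overline\partial V$ on $T_p\mathbb H^2$ with respect to the hyperbolic metric. Then for every $p\in\mathbb H^2$, $$\|\overline\partial\,\mathrm{HL}(X)_p\|\le 6\,w_X(\Pi(p)).$$ -/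

import Mathlib

noncomputable section

namespace HalfPipe

/-! ### Minkowski space and the hyperboloid -/

/-- The ambient vector space of Minkowski space `ℝ^{1,2}`; only its topology is used below, its
geometry is given by `mink`. -/
abbrev R3 : Type := Fin 3 → ℝ

/-- The Lorentzian form of signature `(-,+,+)`. -/
def mink (x y : R3) : ℝ := -(x 0 * y 0) + x 1 * y 1 + x 2 * y 2

/-- The Minkowski cross product `x ⊠ y`. -/
def boxProd (x y : R3) : R3 :=
  ![-(crossProduct x y 0), crossProduct x y 1, crossProduct x y 2]

/-- The property that characterizes the Minkowski cross product. -/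
theorem mink_boxProd (x y v : R3) : mink (boxProd x y) v =
    Matrix.det (Matrix.of ![x, y, v]) := by
  simp [mink, boxProd, cross_apply, Matrix.det_fin_three]
  ring

/-- The hyperbolic plane: the upper sheet of the two-sheeted hyperboloid. -/
abbrev H2 : Type := {p : R3 // mink p p = -1 ∧ 0 < p 0}

/-- The open cone of future timelike vectors. -/
def futureCone : Set R3 := {x | mink x x < 0 ∧ 0 < x 0}

/-- The point of the hyperboloid on the ray through a future timelike vector. -/
def normalize (x : R3) (hx : x ∈ futureCone) : H2 :=
  ⟨(Real.sqrt (-mink x x))⁻¹ • x, by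
    have h1 : 0 < -mink x x := by linarith [hx.1]
    have hs : 0 < Real.sqrt (-mink x x) := Real.sqrt_pos.2 h1
    constructor
    · have h2 : mink ((Real.sqrt (-mink x x))⁻¹ • x) ((Real.sqrt (-mink x x))⁻¹ • x)
          = ((Real.sqrt (-mink x x)) ^ 2)⁻¹ * mink x x := by
        simp only [mink, Pi.smul_apply, smul_eq_mul]
        ring
      rw [h2, Real.sq_sqrt h1.le, inv_neg, neg_mul, inv_mul_cancel₀ hx.1.ne]
    · simpa using mul_pos (inv_pos.2 hs) hx.2⟩

/-- The tangent space `T_p ℍ²`, the Minkowski orthogonal complement of `p`. -/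
def tangent (p : H2) : Submodule ℝ R3 where
  carrier := {v | mink p.1 v = 0}
  add_mem' := by
    intro a b ha hb
    simp only [Set.mem_ofPred_eq, mink, Pi.add_apply] at *
    linarith
  zero_mem' := by simp [mink]
  smul_mem' := by
    intro c x hx
    simp only [Set.mem_ofPred_eq, mink, Pi.smul_apply, smul_eq_mul] at *
    linear_combination c * hx

/-- The Minkowski orthogonal projection `v ↦ v + ⟨p, v⟩ p` onto `T_p ℍ²`. -/
def tangentProj (p : H2) : R3 →ₗ[ℝ] tangent p where
  toFun v := ⟨v + mink p.1 v • p.1, by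
    have h := p.2.1
    simp only [tangent, mink, Submodule.mem_mk, AddSubmonoid.mem_mk, AddSubsemigroup.mem_mk,
      Set.mem_ofPred_eq, Pi.add_apply, Pi.smul_apply, smul_eq_mul] at *
    linear_combination (-(p.1 0 * v 0) + p.1 1 * v 1 + p.1 2 * v 2) * h⟩
  map_add' := by
    intro a b
    ext i
    simp [mink]
    ring
  map_smul' := by
    intro c a
    ext i
    simp [mink]
    ring

/-- The complex structure `J_p v = p ⊠ v` of the hyperbolic plane. -/
def complexJ (p : H2) : tangent p →ₗ[ℝ] tangent p where
  toFun v := ⟨boxProd p.1 v.1, by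
    simp only [tangent, mink, boxProd, cross_apply, Submodule.mem_mk, AddSubmonoid.mem_mk,
      AddSubsemigroup.mem_mk, Set.mem_ofPred_eq]
    simp
    ring⟩
  map_add' := by
    intro a b
    ext i
    fin_cases i <;> simp [boxProd, cross_apply] <;> ring
  map_smul' := by
    intro c a
    ext i
    fin_cases i <;> (simp [boxProd, cross_apply]; try ring)

/-- The norm on `T_p ℍ²` induced by the hyperbolic metric, which is the restriction of `mink`. -/
def hnorm {p : H2} (v : tangent p) : ℝ := Real.sqrt (mink v.1 v.1)

/-! ### Calculus on the hyperbolic plane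

A map on `ℍ²` is differentiated through its extension to the open cone of future timelike vectors
that is constant along rays.  Derivatives in directions tangent to `ℍ²` do not depend on the
extension, and the extension is smooth exactly when the map is. -/

/-- The extension of a map on `ℍ²`, constant along rays, to the future cone (`0` elsewhere). -/
def radialExt {F : Type*} [Zero F] (f : H2 → F) : R3 → F :=
  open Classical in fun x => if hx : x ∈ futureCone then f (normalize x hx) else 0

/-- Smoothness (`C^∞`) of a real function on `ℍ²`. -/
def IsSmooth (u : H2 → ℝ) : Prop :=
  ContDiffOn ℝ ((⊤ : ℕ∞) : WithTop ℕ∞) (radialExt u) futureCone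

/-- The differential `d_p u : T_p ℍ² → ℝ`. -/
def differential (u : H2 → ℝ) (p : H2) : tangent p →ₗ[ℝ] ℝ :=
  (fderiv ℝ (radialExt u) p.1).toLinearMap ∘ₗ (tangent p).subtype

/-- Vector fields on `ℍ²`. -/
abbrev VField : Type := (p : H2) → tangent p

/-- The hyperbolic gradient. -/
def grad (u : H2 → ℝ) : VField := fun p =>
  tangentProj p
    ![-(fderiv ℝ (radialExt u) p.1 (Pi.single 0 1)),
      fderiv ℝ (radialExt u) p.1 (Pi.single 1 1),
      fderiv ℝ (radialExt u) p.1 (Pi.single 2 1)]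

/-- The property that characterizes the gradient. -/
theorem mink_grad (u : H2 → ℝ) (p : H2) (v : tangent p) :
    mink (grad u p).1 v.1 = differential u p v := by
  have hv : mink p.1 v.1 = 0 := v.2
  have hd : differential u p v = fderiv ℝ (radialExt u) p.1 v.1 := rfl
  have hs : v.1 = v.1 0 • (Pi.single 0 1 : R3) + v.1 1 • (Pi.single 1 1 : R3)
      + v.1 2 • (Pi.single 2 1 : R3) := by
    ext i
    fin_cases i <;> simp
  rw [hd]
  conv_rhs => rw [hs]
  rw [map_add, map_add, map_smul, map_smul, map_smul]
  simp only [grad, tangentProj, LinearMap.coe_mk, AddHom.coe_mk, smul_eq_mul]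
  simp only [mink, Pi.add_apply, Pi.smul_apply, smul_eq_mul, Matrix.cons_val_zero,
    Matrix.cons_val_one, Matrix.cons_val] at hv ⊢
  linear_combination (-(p.1 0 * -(fderiv ℝ (radialExt u) p.1 (Pi.single 0 1)))
    + p.1 1 * fderiv ℝ (radialExt u) p.1 (Pi.single 1 1)
    + p.1 2 * fderiv ℝ (radialExt u) p.1 (Pi.single 2 1)) * hv

/-- The Levi-Civita connection of `ℍ²`: `nabla V p` is the map `Y ↦ ∇_Y V` on `T_p ℍ²`, the
tangential part of the derivative of `V` in the flat ambient space. -/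
def nabla (V : VField) (p : H2) : tangent p →ₗ[ℝ] tangent p :=
  tangentProj p ∘ₗ (fderiv ℝ (radialExt fun q => (V q : R3)) p.1).toLinearMap
    ∘ₗ (tangent p).subtype

/-- The hyperbolic Hessian, as a `(1,1)`-tensor. -/
def hess (u : H2 → ℝ) (p : H2) : tangent p →ₗ[ℝ] tangent p := nabla (grad u) p

/-- The Laplace-Beltrami operator of `ℍ²`. -/
def laplacian (u : H2 → ℝ) (p : H2) : ℝ := LinearMap.trace ℝ (tangent p) (hess u p)

/-- The tensor `∂̄V`, given by `∂̄V(Y) = (∇_Y V + J ∇_{JY} V) / 2`. -/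
def dbar (V : VField) (p : H2) : tangent p →ₗ[ℝ] tangent p :=
  (1 / 2 : ℝ) • (nabla V p + complexJ p ∘ₗ nabla V p ∘ₗ complexJ p)

/-- The operator norm of an endomorphism of `T_p ℍ²` with respect to the hyperbolic metric. -/
def tensorNorm {p : H2} (b : tangent p →ₗ[ℝ] tangent p) : ℝ :=
  sSup {r : ℝ | ∃ Y : tangent p, Y ≠ 0 ∧ r = hnorm (b Y) / hnorm Y}

/-- The hyperbolic metric is positive definite on `T_p ℍ²`. -/
theorem sq_le_mink (p : H2) (v : tangent p) :
    v.1 1 ^ 2 + v.1 2 ^ 2 ≤ p.1 0 ^ 2 * mink v.1 v.1 := by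
  have hp := p.2.1
  have hv : mink p.1 v.1 = 0 := v.2
  simp only [mink] at *
  have e : p.1 0 * v.1 0 = p.1 1 * v.1 1 + p.1 2 * v.1 2 := by linarith
  have : p.1 0 ^ 2 * v.1 0 ^ 2 = (p.1 1 * v.1 1 + p.1 2 * v.1 2)^2 := by rw [← e]; ring
  nlinarith [sq_nonneg (p.1 1 * v.1 2 - p.1 2 * v.1 1)]

/-- The quotients in the operator norm are bounded, so that its supremum is a genuine one. -/
theorem bddAbove_quotients {p : H2} (b : tangent p →ₗ[ℝ] tangent p) :
    BddAbove {r : ℝ | ∃ Y : tangent p, Y ≠ 0 ∧ r = hnorm (b Y) / hnorm Y} := by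
  let B := LinearMap.toContinuousLinearMap b
  have hp0 := p.2.2
  have low : ∀ v : tangent p, ‖v‖ ≤ p.1 0 * hnorm v := by
    intro v
    have h := sq_le_mink p v
    have hm : 0 ≤ mink v.1 v.1 := by
      by_contra! hc
      nlinarith [sq_nonneg (v.1 1), sq_nonneg (v.1 2),
        mul_pos_of_neg_of_neg hc (neg_lt_zero.2 (pow_pos hp0 2))]
    have hh : hnorm v ^ 2 = mink v.1 v.1 := Real.sq_sqrt hm
    have hn : 0 ≤ p.1 0 * hnorm v := mul_nonneg hp0.le (Real.sqrt_nonneg _)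
    have h0 : v.1 0 ^ 2 ≤ v.1 1 ^ 2 + v.1 2 ^ 2 := by simp only [mink] at hm; nlinarith
    rw [← hh] at h
    change ‖v.1‖ ≤ _
    rw [pi_norm_le_iff_of_nonneg hn]
    intro i
    rw [Real.norm_eq_abs]
    apply abs_le_of_sq_le_sq _ hn
    fin_cases i <;> simp <;> nlinarith [sq_nonneg (v.1 1), sq_nonneg (v.1 2)]
  have up : ∀ v : tangent p, hnorm v ≤ 2 * ‖v‖ := by
    intro v
    have c : ∀ i, v.1 i ^ 2 ≤ ‖v‖^2 := fun i => by
      have := norm_le_pi_norm v.1 i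
      rw [Real.norm_eq_abs] at this
      change |v.1 i| ≤ ‖v‖ at this
      rw [← sq_abs]; gcongr
    apply Real.sqrt_le_iff.2 ⟨by positivity, ?_⟩
    simp only [mink]
    nlinarith [c 1, c 2, sq_nonneg (v.1 0)]
  refine ⟨2 * (‖B‖ * p.1 0), ?_⟩
  rintro r ⟨Y, hY, rfl⟩
  have hpos : 0 < hnorm Y := by
    have := low Y
    have h2 : 0 < ‖Y‖ := norm_pos_iff.2 hY
    by_contra! hc
    nlinarith
  rw [div_le_iff₀ hpos]
  calc hnorm (b Y) ≤ 2 * ‖b Y‖ := up _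
    _ ≤ 2 * (‖B‖ * ‖Y‖) := by gcongr; exact B.le_opNorm Y
    _ ≤ 2 * (‖B‖ * (p.1 0 * hnorm Y)) := by gcongr; exact low Y
    _ = _ := by ring

/-! ### The Klein disk -/

/-- The radial projection `Π` from the hyperboloid to the Klein disk, the unit disk of `ℂ ≅ ℝ²`. -/
def klein (p : H2) : ℂ := ⟨p.1 1 / p.1 0, p.1 2 / p.1 0⟩

theorem one_eta_mem {η : ℂ} (hη : η ∈ Metric.ball (0 : ℂ) 1) :
    (![1, η.re, η.im] : R3) ∈ futureCone := by
  have h : ‖η‖ < 1 := by simpa using hη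
  have h2 : η.re * η.re + η.im * η.im < 1 := by
    rw [← Complex.normSq_apply, Complex.normSq_eq_norm_sq]
    nlinarith [norm_nonneg η]
  constructor
  · simp [mink]
    linarith
  · simp

/-- The inverse `Π⁻¹` of the radial projection. -/
def kleinInv (η : Metric.ball (0 : ℂ) 1) : H2 := normalize ![1, η.1.re, η.1.im] (one_eta_mem η.2)

/-- `Π⁻¹` is a right inverse of `Π`. -/
theorem klein_kleinInv (η : Metric.ball (0 : ℂ) 1) : klein (kleinInv η) = η.1 := by
  have hx := one_eta_mem η.2
  have hs : Real.sqrt (-mink ![1, η.1.re, η.1.im] ![1, η.1.re, η.1.im]) ≠ 0 :=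
    (Real.sqrt_pos.2 (by linarith [hx.1])).ne'
  apply Complex.ext <;> simp [klein, kleinInv, normalize] <;> field_simp

/-- The function `ū(η) = √(1 - |η|²) u(Π⁻¹(η))` on the Klein disk. -/
def ubar (u : H2 → ℝ) (η : Metric.ball (0 : ℂ) 1) : ℝ :=
  Real.sqrt (1 - ‖η.1‖ ^ 2) * u (kleinInv η)

/-! ### Vector fields on the circle, and their width -/

/-- `X` is a vector field on the circle: `X z` is tangent to the circle at `z`. -/
def IsCircleField (X : Circle → ℂ) : Prop := ∀ z : Circle, inner ℝ (z : ℂ) (X z) = 0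

/-- The support function `φ_X`, the coordinate of `X z` along the unit tangent vector `i z`. -/
def supportFn (X : Circle → ℂ) (z : Circle) : ℝ := inner ℝ (Complex.I * (z : ℂ)) (X z)

/-- A tangent vector field is `X(z) = i z φ_X(z)`. -/
theorem eq_supportFn {X : Circle → ℂ} (hX : IsCircleField X) (z : Circle) :
    X z = Complex.I * (z : ℂ) * (supportFn X z : ℂ) := by
  have h := hX z
  have hz : (z : ℂ).re * (z : ℂ).re + (z : ℂ).im * (z : ℂ).im = 1 := by
    rw [← Complex.normSq_apply]
    exact Circle.normSq_coe z
  simp only [Complex.inner, Complex.mul_re, Complex.conj_re, Complex.conj_im] at h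
  apply Complex.ext
  · simp [supportFn, Complex.inner]
    linear_combination (-(X z).re) * hz + (z : ℂ).re * h
  · simp [supportFn, Complex.inner]
    linear_combination (-(X z).im) * hz + (z : ℂ).im * h

/-- The upper envelope `φ⁻` of the affine functions that are at most `φ` on the circle.  Over the
unit disk its graph is the lower boundary of the convex hull of the graph of `φ`. -/
def lowerHull (φ : Circle → ℝ) (η : ℂ) : ℝ :=
  sSup {t : ℝ | ∃ a : ℂ →ᵃ[ℝ] ℝ, (∀ z : Circle, a (z : ℂ) ≤ φ z) ∧ t = a η}

/-- The lower envelope `φ⁺` of the affine functions that are at least `φ` on the circle. -/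
def upperHull (φ : Circle → ℝ) (η : ℂ) : ℝ :=
  sInf {t : ℝ | ∃ a : ℂ →ᵃ[ℝ] ℝ, (∀ z : Circle, φ z ≤ a (z : ℂ)) ∧ t = a η}

/-- The local width `w_X`, a function on the Klein disk. -/
def localWidth (X : Circle → ℂ) (η : ℂ) : ℝ :=
  (upperHull (supportFn X) η - lowerHull (supportFn X) η) / Real.sqrt (1 - ‖η‖ ^ 2)

/-! ### The mean surface and the vector field `HL(X)` -/

/-- The graph of `u` is a smooth mean surface whose boundary at infinity is the graph of `φ`:
`u` is smooth, `Δu - 2u = 0`, and `ū` extends continuously to the circle by `φ`. -/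
structure IsMeanSurface (φ : Circle → ℝ) (u : H2 → ℝ) : Prop where
  smooth : IsSmooth u
  mean : ∀ p : H2, laplacian u p - 2 * u p = 0
  boundary : ∀ z : Circle,
    Filter.Tendsto (ubar u) (Filter.comap Subtype.val (nhds (z : ℂ))) (nhds (φ z))

/-- The solution `u_X` of the mean surface equation with boundary value `φ_X` (zero if there were
none). -/
def meanFn (X : Circle → ℂ) : H2 → ℝ :=
  open Classical in if h : ∃ u, IsMeanSurface (supportFn X) u then h.choose else 0

/-- The vector field `HL(X) = J grad u_X`. -/
def HL (X : Circle → ℂ) : VField := fun p => complexJ p (grad (meanFn X) p)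

end HalfPipe

end

noncomputable section

namespace HalfPipe

open Real MeasureTheory Set Filter Topology

/-! ### Integrals against powers of null forms -/

/-! Write `ℓ_θ(x)` for `nullForm θ x`. The solution with boundary value `φ` is explicit: `u(q) =
(2π)⁻¹ ∫ φ(e^{iθ}) ℓ_θ(q)⁻² dθ` (`potential`). Its kernel is positive, and it reproduces affine
functions: if `φ = a` is affine, then `u(q) = q₀ a(Π q)` (`potential_affine`), by differentiating
the Poisson integral `∫ ℓ_θ⁻¹ = 2π / √(-⟨x,x⟩)`. Hence `u` lies between `q₀ a(Π q)` and `q₀ b(Π q)`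
for all affine `a ≤ φ ≤ b`. Affine barriers touching `φ` up to `ε` at a boundary point give the
boundary values, and a maximum principle gives uniqueness (`IsMeanSurface.le`).

For the estimate, `J` is parallel (`nabla_complexJ`), so `∂̄(J grad u)(Y) = (J Hess u(Y) - Hess
u(JY)) / 2`. This kills the multiples of the identity in the Hessian, and only the kernel `6
(ℓ(Y)ℓ(Z) - ℓ(JY)ℓ(JZ)) ℓ(p)⁻⁴` remains, at most `6 |Y||Z| ℓ(p)⁻²` because `ℓ(Y)² + ℓ(JY)² = ℓ(p)²
|Y|²`. Affine boundary data contribute nothing, so `φ` may be replaced by `φ - a ≥ 0` for an affine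
`a ≤ φ`; the kernel bound then integrates to `6 |Y||Z| (u(p) - p₀ a(Π p))`
(`mink_hess_sub_hess_complexJ_le`). Bounding `u` above by `φ⁺` and taking the supremum over `a`
produces the local width (`le_localWidth`). The argument yields the constant 3. -/

/-- The pairing `-⟨x, (1, cos θ, sin θ)⟩` with a null vector, as a linear form in `x`. -/
def nullForm (θ : ℝ) : R3 →L[ℝ] ℝ :=
  ContinuousLinearMap.proj 0 - cos θ • ContinuousLinearMap.proj 1
    - sin θ • ContinuousLinearMap.proj 2

theorem nullForm_apply (θ : ℝ) (x : R3) : nullForm θ x = x 0 - cos θ * x 1 - sin θ * x 2 := rfl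

theorem continuous_nullForm : Continuous nullForm := by
  unfold nullForm
  fun_prop

theorem isOpen_futureCone : IsOpen futureCone := by
  have h1 : Continuous fun x : R3 => mink x x := by unfold mink; fun_prop
  have h2 : Continuous fun x : R3 => x 0 := by fun_prop
  exact (isOpen_lt h1 continuous_const).inter (isOpen_lt continuous_const h2)

/-- Cauchy–Schwarz in the last two coordinates. The bound is uniform in `θ`, which gives both
positivity on the cone and the domination needed to differentiate under the integral. -/
theorem sub_sqrt_le_nullForm (θ : ℝ) (x : R3) :
    x 0 - √(x 1 ^ 2 + x 2 ^ 2) ≤ nullForm θ x := by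
  rw [nullForm_apply]
  have : cos θ * x 1 + sin θ * x 2 ≤ √(x 1 ^ 2 + x 2 ^ 2) := by
    apply Real.le_sqrt_of_sq_le
    nlinarith [sq_nonneg (cos θ * x 2 - sin θ * x 1), sin_sq_add_cos_sq θ,
      mul_nonneg (sq_nonneg (x 1)) (sq_nonneg (x 1))]
  linarith

theorem sqrt_lt_of_mem_futureCone {x : R3} (hx : x ∈ futureCone) :
    √(x 1 ^ 2 + x 2 ^ 2) < x 0 := by
  have h := hx.1
  simp only [mink] at h
  rw [Real.sqrt_lt' hx.2]
  nlinarith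

theorem nullForm_pos {x : R3} (hx : x ∈ futureCone) (θ : ℝ) : 0 < nullForm θ x :=
  (sub_pos.2 (sqrt_lt_of_mem_futureCone hx)).trans_le (sub_sqrt_le_nullForm θ x)

/-- The integral of `ψ` against the `k`-th power of the reciprocals of the null forms. -/
def kerInt (ψ : ℝ → ℝ) (k : ℕ) (x : R3) : ℝ :=
  ∫ θ in 0..2 * π, ψ θ * (nullForm θ x)⁻¹ ^ k

theorem continuous_kernel {ψ : ℝ → ℝ} (hψ : Continuous ψ) (k : ℕ) {x : R3} (hx : x ∈ futureCone) :
    Continuous fun θ => ψ θ * (nullForm θ x)⁻¹ ^ k := by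
  have h : Continuous fun θ => nullForm θ x := continuous_nullForm.clm_apply continuous_const
  exact hψ.mul ((h.inv₀ fun θ => (nullForm_pos hx θ).ne').pow k)

theorem hasDerivAt_inv_pow (k : ℕ) {t : ℝ} (ht : t ≠ 0) :
    HasDerivAt (fun t : ℝ => t⁻¹ ^ k) (-k * t⁻¹ ^ (k + 1)) t := by
  refine ((hasDerivAt_inv ht).pow k).congr_deriv ?_
  -- The power rule produces the exponent `k - 1`, truncated at `k = 0`.
  rcases k with _ | k
  · simp
  · simp only [Nat.add_sub_cancel]
    push_cast
    rw [← inv_pow]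
    ring

theorem hasFDerivAt_kerInt {ψ : ℝ → ℝ} (hψ : Continuous ψ) (k : ℕ) {x : R3}
    (hx : x ∈ futureCone) :
    HasFDerivAt (kerInt ψ k)
      (∫ θ in 0..2 * π, (ψ θ * (-k * (nullForm θ x)⁻¹ ^ (k + 1))) • nullForm θ) x := by
  -- Half of the lower bound of the null forms at `x`: by continuity all null forms stay above `δ`
  -- on a neighbourhood of `x`, so `δ⁻¹` dominates their reciprocals there.
  set δ := (x 0 - √(x 1 ^ 2 + x 2 ^ 2)) / 2 with hδ
  have hδ0 : 0 < δ := half_pos (sub_pos.2 (sqrt_lt_of_mem_futureCone hx))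
  have hs : {y : R3 | δ < y 0 - √(y 1 ^ 2 + y 2 ^ 2)} ∈ 𝓝 x := by
    apply (isOpen_lt continuous_const (by fun_prop)).mem_nhds
    change δ < x 0 - √(x 1 ^ 2 + x 2 ^ 2)
    linarith
  have hpos : ∀ y ∈ {y : R3 | δ < y 0 - √(y 1 ^ 2 + y 2 ^ 2)}, ∀ θ, δ < nullForm θ y :=
    fun y hy θ => lt_of_lt_of_le hy (sub_sqrt_le_nullForm θ y)
  have hc : ∀ k : ℕ, Continuous fun θ => ψ θ * (-k * (nullForm θ x)⁻¹ ^ (k + 1)) := fun k =>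
    hψ.mul (continuous_kernel continuous_const (k + 1) hx)
  refine intervalIntegral.hasFDerivAt_integral_of_dominated_of_fderiv_le
    (F := fun y θ => ψ θ * (nullForm θ y)⁻¹ ^ k)
    (F' := fun y θ => (ψ θ * (-k * (nullForm θ y)⁻¹ ^ (k + 1))) • nullForm θ)
    (bound := fun θ => |ψ θ| * (k * δ⁻¹ ^ (k + 1)) * ‖nullForm θ‖) hs ?_ ?_ ?_ ?_ ?_ ?_
  · filter_upwards [isOpen_futureCone.mem_nhds hx] with y hy
    exact (continuous_kernel hψ k hy).aestronglyMeasurable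
  · exact (continuous_kernel hψ k hx).intervalIntegrable _ _
  · exact ((hc k).smul continuous_nullForm).aestronglyMeasurable
  · refine Eventually.of_forall fun θ _ y hy => ?_
    have h := hpos y hy θ
    rw [norm_smul, norm_mul, norm_mul, norm_pow, norm_neg, norm_inv, Real.norm_of_nonneg
      (hδ0.trans h).le, Real.norm_natCast, Real.norm_eq_abs]
    have := inv_nonneg.2 (hδ0.trans h).le
    gcongr
  · exact (((hψ.abs).mul continuous_const).mul continuous_nullForm.norm).intervalIntegrable _ _
  · refine Eventually.of_forall fun θ _ y hy => ?_
    have h := hpos y hy θ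
    have h2 := ((hasDerivAt_inv_pow k (hδ0.trans h).ne').comp_hasFDerivAt y
      (nullForm θ).hasFDerivAt).const_mul (ψ θ)
    rw [mul_smul]
    exact h2

theorem fderiv_kerInt {ψ : ℝ → ℝ} (hψ : Continuous ψ) (k : ℕ) {x : R3}
    (hx : x ∈ futureCone) (v : R3) :
    fderiv ℝ (kerInt ψ k) x v = kerInt (fun θ => -k * (ψ θ * nullForm θ v)) (k + 1) x := by
  rw [(hasFDerivAt_kerInt hψ k hx).fderiv, ContinuousLinearMap.intervalIntegral_apply]
  · apply intervalIntegral.integral_congr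
    intro θ _
    simp only [_root_.smul_apply, smul_eq_mul]
    ring
  · exact ((hψ.mul (continuous_kernel continuous_const (k + 1) hx)).smul
      continuous_nullForm).intervalIntegrable _ _

/-- Each directional derivative is again an integral of this kind, with another continuous density
and exponent `k + 1`; hence the induction over all `ψ` and `k` at once. -/
theorem contDiffOn_kerInt {ψ : ℝ → ℝ} (hψ : Continuous ψ) (k : ℕ) :
    ContDiffOn ℝ ((⊤ : ℕ∞) : WithTop ℕ∞) (kerInt ψ k) futureCone := by
  rw [contDiffOn_infty]
  intro n
  induction n generalizing ψ k with
  | zero =>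
    rw [Nat.cast_zero, contDiffOn_zero]
    exact fun x hx => (hasFDerivAt_kerInt hψ k hx).continuousAt.continuousWithinAt
  | succ n ih =>
    push_cast
    rw [contDiffOn_succ_iff_fderiv_of_isOpen isOpen_futureCone]
    refine ⟨fun x hx => (hasFDerivAt_kerInt hψ k hx).differentiableAt.differentiableWithinAt,
      by simp, ?_⟩
    rw [contDiffOn_clm_apply]
    intro v
    refine (ih (ψ := fun θ => -k * (ψ θ * nullForm θ v)) ?_ (k + 1)).congr
      fun x hx => fderiv_kerInt hψ k hx v
    have := continuous_nullForm
    fun_prop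

/-- Up to the factor `s = √(-⟨x,x⟩)`, the reciprocal null form is the Poisson kernel of the unit
disk, whose circle average is 1. -/
theorem kerInt_one_one {x : R3} (hx : x ∈ futureCone) :
    kerInt (fun _ => 1) 1 x = 2 * π * (√(-mink x x))⁻¹ := by
  set s := √(-mink x x) with hs
  have h1 : 0 < -mink x x := by linarith [hx.1]
  have hs0 : 0 < s := Real.sqrt_pos.2 h1
  have hs2 : s ^ 2 = x 0 ^ 2 - x 1 ^ 2 - x 2 ^ 2 := by
    rw [hs, Real.sq_sqrt h1.le]; simp only [mink]; ring
  have hx0 : 0 < x 0 := hx.2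
  have hc : 0 < x 0 + s := by positivity
  -- The point of the Poincaré disk on the ray of `x`: here `1 - |w|² = 2s / (x₀ + s)` and `|e^{iθ}
  -- - w|² = 2 ℓ_θ(x) / (x₀ + s)`, with quotient `s / ℓ_θ(x)`.
  set w : ℂ := ⟨x 1 / (x 0 + s), x 2 / (x 0 + s)⟩ with hw
  have hw2 : ‖w‖ ^ 2 = (x 0 - s) / (x 0 + s) := by
    rw [← Complex.normSq_eq_norm_sq, Complex.normSq_apply]
    simp only [hw]
    field_simp
    linarith
  have hwb : w ∈ Metric.ball (0 : ℂ) 1 := by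
    rw [mem_ball_zero_iff, ← abs_norm, ← sq_lt_one_iff_abs_lt_one, hw2, div_lt_one hc]
    linarith
  have hP := InnerProductSpace.HarmonicOnNhd.circleAverage_poissonKernel_smul (f := fun _ : ℂ => (1 : ℝ))
    (c := 0) (R := 1) (w := w) (fun z _ => ?_) hwb
  · rw [Real.circleAverage_def] at hP
    have he : ∀ θ : ℝ, (poissonKernel 0 w • fun _ : ℂ => (1 : ℝ)) (circleMap 0 1 θ)
        = s * (1 * (nullForm θ x)⁻¹ ^ 1) := by
      intro θ
      have hl := nullForm_pos hx θ
      have hz : ‖circleMap 0 1 θ - w‖ ^ 2 = 2 * nullForm θ x / (x 0 + s) := by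
        rw [← Complex.normSq_eq_norm_sq, Complex.normSq_apply]
        simp only [hw, circleMap_zero, nullForm_apply, Complex.sub_re, Complex.sub_im,
          Complex.ofReal_one, one_mul, Complex.exp_ofReal_mul_I_re, Complex.exp_ofReal_mul_I_im]
        field_simp
        linear_combination (x 0 + s) ^ 2 * sin_sq_add_cos_sq θ + hs2
      simp only [Pi.smul_apply', poissonKernel_def, sub_zero, hz, hw2, smul_eq_mul, mul_one,
        pow_one, one_mul]
      simp only [norm_circleMap_zero, abs_one]
      field_simp
      ring
    simp_rw [he] at hP
    rw [intervalIntegral.integral_const_mul, smul_eq_mul] at hP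
    change (2 * π)⁻¹ * (s * kerInt (fun _ => 1) 1 x) = 1 at hP
    field_simp at hP ⊢
    linarith
  · exact InnerProductSpace.harmonicAt_const _

theorem hasDerivAt_line (p v : R3) : HasDerivAt (fun t : ℝ => p + t • v) v 0 := by
  simpa using ((hasDerivAt_id (0 : ℝ)).smul_const v).const_add p

theorem tendsto_line (p v : R3) : Tendsto (fun t : ℝ => p + t • v) (𝓝 0) (𝓝 p) := by
  have : Continuous fun t : ℝ => p + t • v := by fun_prop
  simpa using this.tendsto 0

theorem hasDerivAt_neg_mink_line (q : H2) (v : R3) :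
    HasDerivAt (fun t : ℝ => -mink (q.1 + t • v) (q.1 + t • v)) (-2 * mink q.1 v) 0 := by
  have hi : ∀ i, HasDerivAt (fun t : ℝ => (q.1 + t • v) i) (v i) 0 :=
    hasDerivAt_pi.1 (hasDerivAt_line q.1 v)
  have := ((((hi 0).mul (hi 0)).neg.add ((hi 1).mul (hi 1))).add ((hi 2).mul (hi 2))).neg
  refine this.congr_deriv ?_
  simp [mink]
  ring

/-- The kernel `nullForm ^ (-2)` reproduces linear functions. -/
theorem kerInt_linear (q : H2) (v : R3) :
    kerInt (fun θ => nullForm θ v) 2 q.1 = 2 * π * (-mink q.1 v) := by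
  have hq : q.1 ∈ futureCone := ⟨by rw [q.2.1]; norm_num, q.2.2⟩
  -- Both sides of `kerInt_one_one` are differentiated at `q` in the direction `v`; on the left this
  -- turns `ℓ⁻¹` into `-ℓ(v) ℓ⁻²`.
  have h1 := fderiv_kerInt (ψ := fun _ => 1) continuous_const 1 hq v
  have h2 : kerInt (fun _ => 1) 1 =ᶠ[𝓝 q.1] fun x => 2 * π * (√(-mink x x))⁻¹ := by
    filter_upwards [isOpen_futureCone.mem_nhds hq] with x hx using kerInt_one_one hx
  have h3 : HasDerivAt (fun t : ℝ => 2 * π * (√(-mink (q.1 + t • v) (q.1 + t • v)))⁻¹)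
      (2 * π * mink q.1 v) 0 := by
    have h0 : -mink (q.1 + (0 : ℝ) • v) (q.1 + (0 : ℝ) • v) = 1 := by simp [q.2.1]
    have h4 := (((hasDerivAt_neg_mink_line q v).sqrt (by rw [h0]; norm_num)).inv (by rw [h0]; norm_num)).const_mul (2 * π)
    refine h4.congr_deriv ?_
    rw [h0]
    norm_num
    ring
  have h5 : HasDerivAt (fun t : ℝ => kerInt (fun _ => 1) 1 (q.1 + t • v))
      (fderiv ℝ (kerInt (fun _ => 1) 1) q.1 v) 0 := by
    exact HasFDerivAt.comp_hasDerivAt_of_eq 0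
      (hasFDerivAt_kerInt continuous_const 1 hq).differentiableAt.hasFDerivAt
      (hasDerivAt_line q.1 v) (by simp)
  have h6 := h5.unique (h3.congr_of_eventuallyEq ((tendsto_line q.1 v).eventually h2))
  rw [h1] at h6
  have h7 : kerInt (fun θ => nullForm θ v) 2 q.1
      = -kerInt (fun θ => -(1 : ℕ) * ((fun _ => 1) θ * nullForm θ v)) (1 + 1) q.1 := by
    simp only [kerInt, ← intervalIntegral.integral_neg]
    apply intervalIntegral.integral_congr
    intro θ _
    push_cast
    ring
  rw [h7, h6]
  ring

/-! ### Differentiation along the hyperboloid -/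

theorem mem_futureCone (q : H2) : q.1 ∈ futureCone := ⟨by rw [q.2.1]; norm_num, q.2.2⟩

theorem mink_comm (x y : R3) : mink x y = mink y x := by simp only [mink]; ring

theorem mink_add_left (x y z : R3) : mink (x + y) z = mink x z + mink y z := by
  simp only [mink, Pi.add_apply]; ring

theorem mink_smul_left (c : ℝ) (x z : R3) : mink (c • x) z = c * mink x z := by
  simp only [mink, Pi.smul_apply, smul_eq_mul]; ring

/-- The Lorentzian form with a fixed vector, as a continuous linear form. -/
def minkCLM (z : R3) : R3 →L[ℝ] ℝ :=
  -(z 0 • ContinuousLinearMap.proj 0) + z 1 • ContinuousLinearMap.proj 1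
    + z 2 • ContinuousLinearMap.proj 2

theorem minkCLM_apply (z x : R3) : minkCLM z x = mink x z := by
  simp [minkCLM, mink]; ring

/-- The radial retraction of the future cone onto the hyperboloid. -/
def retract (x : R3) : R3 := (√(-mink x x))⁻¹ • x

theorem coe_normalize (x : R3) (hx : x ∈ futureCone) : (normalize x hx).1 = retract x := rfl

theorem radialExt_of_mem {F : Type*} [Zero F] (f : H2 → F) {x : R3} (hx : x ∈ futureCone) :
    radialExt f x = f (normalize x hx) := by
  simp [radialExt, hx]

theorem retract_coe (q : H2) : retract q.1 = q.1 := by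
  simp [retract, q.2.1]

theorem normalize_coe (q : H2) : normalize q.1 (mem_futureCone q) = q :=
  Subtype.ext (retract_coe q)

theorem radialExt_coe {F : Type*} [Zero F] (f : H2 → F) (q : H2) : radialExt f q.1 = f q := by
  rw [radialExt_of_mem f (mem_futureCone q), normalize_coe]

theorem smul_mem_futureCone {c : ℝ} (hc : 0 < c) {x : R3} (hx : x ∈ futureCone) :
    c • x ∈ futureCone := by
  refine ⟨?_, by simpa using mul_pos hc hx.2⟩
  rw [mink_smul_left, mink_comm, mink_smul_left]
  have := hx.1
  exact mul_neg_of_pos_of_neg hc (mul_neg_of_pos_of_neg hc this)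

theorem radialExt_smul_coe {F : Type*} [Zero F] (f : H2 → F) {c : ℝ} (hc : 0 < c) (q : H2) :
    radialExt f (c • q.1) = f q := by
  rw [radialExt_of_mem f (smul_mem_futureCone hc (mem_futureCone q))]
  congr 1
  apply Subtype.ext
  rw [coe_normalize, retract, mink_smul_left, mink_comm, mink_smul_left, q.2.1, smul_smul]
  rw [show -(c * (c * -1)) = c * c by ring, Real.sqrt_mul_self hc.le, inv_mul_cancel₀ hc.ne',
    one_smul]

theorem contDiffOn_retract :
    ContDiffOn ℝ ((⊤ : ℕ∞) : WithTop ℕ∞) retract futureCone := by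
  have h1 : ContDiff ℝ ((⊤ : ℕ∞) : WithTop ℕ∞) fun x : R3 => -mink x x := by
    unfold mink; fun_prop
  have h2 : ContDiffOn ℝ ((⊤ : ℕ∞) : WithTop ℕ∞) (fun x : R3 => √(-mink x x)) futureCone :=
    h1.contDiffOn.sqrt fun x hx => by linarith [hx.1]
  exact (h2.inv fun x hx => (Real.sqrt_pos.2 (by linarith [hx.1])).ne').smul contDiffOn_id

theorem differentiableAt_retract (q : H2) : DifferentiableAt ℝ retract q.1 :=
  (contDiffOn_retract.contDiffAt (isOpen_futureCone.mem_nhds (mem_futureCone q))).differentiableAt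
    (by simp)

theorem fderiv_eq_of_hasDerivAt {E : Type*} [NormedAddCommGroup E] [NormedSpace ℝ E] {f : R3 → E}
    {p v : R3} {f' : E} (hf : DifferentiableAt ℝ f p)
    (h : HasDerivAt (fun t : ℝ => f (p + t • v)) f' 0) : fderiv ℝ f p v = f' :=
  (HasFDerivAt.comp_hasDerivAt_of_eq 0 hf.hasFDerivAt (hasDerivAt_line p v) (by simp)).unique h

theorem fderiv_retract (q : H2) (v : R3) :
    fderiv ℝ retract q.1 v = v + mink q.1 v • q.1 := by
  apply fderiv_eq_of_hasDerivAt (differentiableAt_retract q)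
  have h0 : -mink (q.1 + (0 : ℝ) • v) (q.1 + (0 : ℝ) • v) = 1 := by simp [q.2.1]
  have h1 := ((hasDerivAt_neg_mink_line q v).sqrt (by rw [h0]; norm_num)).inv
    (by rw [h0]; norm_num)
  refine (h1.smul (hasDerivAt_line q.1 v)).congr_deriv ?_
  simp only [Pi.inv_apply, h0]
  simp [neg_div]

theorem isSmooth_of_extension {u : H2 → ℝ} {F : R3 → ℝ}
    (hF : ContDiffOn ℝ ((⊤ : ℕ∞) : WithTop ℕ∞) F futureCone) (hu : ∀ q : H2, u q = F q.1) :
    IsSmooth u := by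
  refine (hF.comp contDiffOn_retract fun x hx => mem_futureCone (normalize x hx)).congr ?_
  intro x hx
  rw [radialExt_of_mem u hx, hu]
  rfl

theorem eq_of_forall_mink {p : H2} {x y : tangent p} (h : ∀ Z : tangent p, mink x.1 Z.1 = mink y.1 Z.1) :
    x = y := by
  rw [← sub_eq_zero]
  set w := x - y with hw
  have h0 : mink w.1 w.1 = 0 := by
    have := h w
    have e : w.1 = x.1 + (-1 : ℝ) • y.1 := by rw [hw]; simp [sub_eq_add_neg]
    rw [show mink w.1 w.1 = mink (x.1 + (-1 : ℝ) • y.1) w.1 by rw [← e], mink_add_left,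
      mink_smul_left, this]
    ring
  have h1 := sq_le_mink p w
  rw [h0, mul_zero] at h1
  have w1 : w.1 1 = 0 := by nlinarith [sq_nonneg (w.1 1), sq_nonneg (w.1 2)]
  have w2 : w.1 2 = 0 := by nlinarith [sq_nonneg (w.1 1), sq_nonneg (w.1 2)]
  have w0 : w.1 0 = 0 := by
    have hm : mink p.1 w.1 = 0 := w.2
    simpa [mink, w1, w2, p.2.2.ne'] using hm
  ext i
  fin_cases i <;> simp [w0, w1, w2]

/-! ### An orthonormal frame -/

/-- The image of `∂₁` under the boost that moves the base point of `ℍ²` to `p`. -/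
def frameFst (p : H2) : tangent p :=
  ⟨![p.1 1, 1 + p.1 1 ^ 2 / (1 + p.1 0), p.1 1 * p.1 2 / (1 + p.1 0)], by
    have h := p.2.1
    have h0 : (1 + p.1 0) ≠ 0 := by linarith [p.2.2]
    change mink _ _ = 0
    simp [mink] at h ⊢
    field_simp
    linear_combination p.1 1 * h⟩

/-- The image of `∂₂` under the boost that moves the base point of `ℍ²` to `p`. -/
def frameSnd (p : H2) : tangent p :=
  ⟨![p.1 2, p.1 1 * p.1 2 / (1 + p.1 0), 1 + p.1 2 ^ 2 / (1 + p.1 0)], by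
    have h := p.2.1
    have h0 : (1 + p.1 0) ≠ 0 := by linarith [p.2.2]
    change mink _ _ = 0
    simp [mink] at h ⊢
    field_simp
    linear_combination p.1 2 * h⟩

theorem mink_frameFst {p : H2} (v : tangent p) :
    mink v.1 (frameFst p).1 = v.1 1 - p.1 1 * v.1 0 / (1 + p.1 0) := by
  have h0 : (1 + p.1 0) ≠ 0 := by linarith [p.2.2]
  have hv : mink p.1 v.1 = 0 := v.2
  simp [mink, frameFst] at hv ⊢
  field_simp
  linear_combination p.1 1 * hv

theorem mink_frameSnd {p : H2} (v : tangent p) :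
    mink v.1 (frameSnd p).1 = v.1 2 - p.1 2 * v.1 0 / (1 + p.1 0) := by
  have h0 : (1 + p.1 0) ≠ 0 := by linarith [p.2.2]
  have hv : mink p.1 v.1 = 0 := v.2
  simp [mink, frameSnd] at hv ⊢
  field_simp
  linear_combination p.1 2 * hv

theorem frame_expansion {p : H2} (v : tangent p) :
    mink v.1 (frameFst p).1 • frameFst p + mink v.1 (frameSnd p).1 • frameSnd p = v := by
  have h0 : (1 + p.1 0) ≠ 0 := by linarith [p.2.2]
  have hv : mink p.1 v.1 = 0 := v.2
  have hp := p.2.1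
  rw [mink_frameFst, mink_frameSnd]
  have e0 : (v.1 1 - p.1 1 * v.1 0 / (1 + p.1 0)) * p.1 1
      + (v.1 2 - p.1 2 * v.1 0 / (1 + p.1 0)) * p.1 2 = v.1 0 := by
    simp only [mink] at hp hv
    field_simp
    linear_combination (1 + p.1 0) * hv - v.1 0 * hp
  ext i
  fin_cases i
  · simpa [frameFst, frameSnd] using e0
  · simp [frameFst, frameSnd]
    linear_combination (p.1 1 / (1 + p.1 0)) * e0
  · simp [frameFst, frameSnd]
    linear_combination (p.1 2 / (1 + p.1 0)) * e0

theorem mink_frameFst_frameFst (p : H2) : mink (frameFst p).1 (frameFst p).1 = 1 := by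
  have h0 : (1 + p.1 0) ≠ 0 := by linarith [p.2.2]
  rw [mink_frameFst]
  simp [frameFst]
  field_simp
  ring

theorem mink_frameSnd_frameSnd (p : H2) : mink (frameSnd p).1 (frameSnd p).1 = 1 := by
  have h0 : (1 + p.1 0) ≠ 0 := by linarith [p.2.2]
  rw [mink_frameSnd]
  simp [frameSnd]
  field_simp
  ring

theorem mink_frameSnd_frameFst (p : H2) : mink (frameSnd p).1 (frameFst p).1 = 0 := by
  rw [mink_frameFst]
  simp [frameSnd]

theorem mink_frameFst_frameSnd (p : H2) : mink (frameFst p).1 (frameSnd p).1 = 0 := by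
  rw [mink_comm, mink_frameSnd_frameFst]

/-- The coordinates of tangent vectors in the orthonormal frame. -/
def frameEquiv (p : H2) : tangent p ≃ₗ[ℝ] (Fin 2 → ℝ) where
  toFun v := ![mink v.1 (frameFst p).1, mink v.1 (frameSnd p).1]
  map_add' x y := by
    ext i
    fin_cases i <;> simp [mink_add_left]
  map_smul' c x := by
    ext i
    fin_cases i <;> simp [mink_smul_left]
  invFun c := c 0 • frameFst p + c 1 • frameSnd p
  left_inv v := frame_expansion v
  right_inv c := by
    ext i
    fin_cases i <;> simp [mink_add_left, mink_smul_left, mink_frameFst_frameFst,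
      mink_frameSnd_frameSnd, mink_frameSnd_frameFst, mink_frameFst_frameSnd]

theorem trace_eq_frame {p : H2} (T : tangent p →ₗ[ℝ] tangent p) :
    LinearMap.trace ℝ (tangent p) T = mink (T (frameFst p)).1 (frameFst p).1
      + mink (T (frameSnd p)).1 (frameSnd p).1 := by
  rw [LinearMap.trace_eq_matrix_trace ℝ (Module.Basis.ofEquivFun (frameEquiv p)) T,
    Matrix.trace_fin_two, LinearMap.toMatrix_apply, LinearMap.toMatrix_apply]
  have h1 : (frameEquiv p).symm (Pi.single 0 1) = frameFst p := by
    change (Pi.single 0 1 : Fin 2 → ℝ) 0 • frameFst p + (Pi.single 0 1 : Fin 2 → ℝ) 1 • frameSnd p = _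
    simp
  have h2 : (frameEquiv p).symm (Pi.single 1 1) = frameSnd p := by
    change (Pi.single 1 1 : Fin 2 → ℝ) 0 • frameFst p + (Pi.single 1 1 : Fin 2 → ℝ) 1 • frameSnd p = _
    simp
  simp only [Module.Basis.coe_ofEquivFun, h1, h2, Module.Basis.ofEquivFun_repr_apply]
  rfl

theorem mink_eq_frame {p : H2} (x : R3) (v : tangent p) :
    mink v.1 x = mink v.1 (frameFst p).1 * mink (frameFst p).1 x
      + mink v.1 (frameSnd p).1 * mink (frameSnd p).1 x := by
  conv_lhs => rw [← frame_expansion v]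
  simp [mink_add_left, mink_smul_left]

/-! ### Gradient, Hessian and Laplacian computed from an arbitrary smooth extension -/

section extension

variable {u : H2 → ℝ} {F : R3 → ℝ}

theorem differentiableAt_of_contDiffOn {E : Type*} [NormedAddCommGroup E] [NormedSpace ℝ E]
    {F : R3 → E} (hF : ContDiffOn ℝ ((⊤ : ℕ∞) : WithTop ℕ∞) F futureCone) (q : H2) :
    DifferentiableAt ℝ F q.1 :=
  (hF.contDiffAt (isOpen_futureCone.mem_nhds (mem_futureCone q))).differentiableAt (by simp)

theorem contDiffOn_fderiv (hF : ContDiffOn ℝ ((⊤ : ℕ∞) : WithTop ℕ∞) F futureCone) :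
    ContDiffOn ℝ ((⊤ : ℕ∞) : WithTop ℕ∞) (fderiv ℝ F) futureCone :=
  hF.fderiv_of_isOpen isOpen_futureCone (by simp)

/-- Chain rule through the radial retraction, whose derivative at a point of the hyperboloid is the
tangential projection. -/
theorem fderiv_radialExt (hF : ContDiffOn ℝ ((⊤ : ℕ∞) : WithTop ℕ∞) F futureCone)
    (hu : ∀ q : H2, u q = F q.1) (q : H2) (v : R3) :
    fderiv ℝ (radialExt u) q.1 v = fderiv ℝ F q.1 v + mink q.1 v * fderiv ℝ F q.1 q.1 := by
  have h1 : radialExt u =ᶠ[𝓝 q.1] F ∘ retract := by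
    filter_upwards [isOpen_futureCone.mem_nhds (mem_futureCone q)] with x hx
    rw [radialExt_of_mem u hx, hu]
    rfl
  rw [h1.fderiv_eq, fderiv_comp _ (by rw [retract_coe]; exact differentiableAt_of_contDiffOn hF q)
    (differentiableAt_retract q), retract_coe]
  simp [fderiv_retract]

/-- The ambient expression of the hyperbolic gradient in terms of an extension. -/
def ambientGrad (F : R3 → ℝ) (x : R3) : R3 :=
  ![-(fderiv ℝ F x (Pi.single 0 1)), fderiv ℝ F x (Pi.single 1 1), fderiv ℝ F x (Pi.single 2 1)]
    + fderiv ℝ F x x • x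

theorem mink_ambientGrad (F : R3 → ℝ) (x v : R3) :
    mink (ambientGrad F x) v = fderiv ℝ F x v + fderiv ℝ F x x * mink x v := by
  have hs : v = v 0 • (Pi.single 0 1 : R3) + v 1 • (Pi.single 1 1 : R3)
      + v 2 • (Pi.single 2 1 : R3) := by
    ext i
    fin_cases i <;> simp
  conv_rhs => enter [1]; rw [hs]
  simp [ambientGrad, mink]
  ring

theorem grad_eq_ambientGrad (hF : ContDiffOn ℝ ((⊤ : ℕ∞) : WithTop ℕ∞) F futureCone)
    (hu : ∀ q : H2, u q = F q.1) (q : H2) : (grad u q).1 = ambientGrad F q.1 := by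
  have h1 : (![-(fderiv ℝ (radialExt u) q.1 (Pi.single 0 1)),
      fderiv ℝ (radialExt u) q.1 (Pi.single 1 1),
      fderiv ℝ (radialExt u) q.1 (Pi.single 2 1)] : R3) = ambientGrad F q.1 := by
    simp only [fderiv_radialExt hF hu]
    ext i
    fin_cases i <;> simp [ambientGrad, mink] <;> ring
  simp only [grad, h1, tangentProj, LinearMap.coe_mk, AddHom.coe_mk]
  rw [mink_comm, mink_ambientGrad, q.2.1]
  simp

theorem contDiffOn_ambientGrad (hF : ContDiffOn ℝ ((⊤ : ℕ∞) : WithTop ℕ∞) F futureCone) :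
    ContDiffOn ℝ ((⊤ : ℕ∞) : WithTop ℕ∞) (ambientGrad F) futureCone := by
  have h := contDiffOn_fderiv hF
  have h2 : ∀ v, ContDiffOn ℝ ((⊤ : ℕ∞) : WithTop ℕ∞) (fun x => fderiv ℝ F x v) futureCone :=
    fun v => h.clm_apply contDiffOn_const
  refine ContDiffOn.add (contDiffOn_pi.2 fun i => ?_) ((h.clm_apply contDiffOn_id).smul contDiffOn_id)
  fin_cases i
  · exact (h2 _).neg
  · exact h2 _
  · exact h2 _

theorem radialExt_grad_eventuallyEq (hF : ContDiffOn ℝ ((⊤ : ℕ∞) : WithTop ℕ∞) F futureCone)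
    (hu : ∀ q : H2, u q = F q.1) (q : H2) :
    (radialExt fun q => (grad u q).1) =ᶠ[𝓝 q.1] ambientGrad F ∘ retract := by
  filter_upwards [isOpen_futureCone.mem_nhds (mem_futureCone q)] with x hx
  rw [radialExt_of_mem _ hx, grad_eq_ambientGrad hF hu]
  rfl

theorem differentiableAt_radialExt_grad
    (hF : ContDiffOn ℝ ((⊤ : ℕ∞) : WithTop ℕ∞) F futureCone)
    (hu : ∀ q : H2, u q = F q.1) (q : H2) :
    DifferentiableAt ℝ (radialExt fun q => (grad u q).1) q.1 := by
  refine DifferentiableAt.congr_of_eventuallyEq ?_ (radialExt_grad_eventuallyEq hF hu q)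
  refine DifferentiableAt.comp _ ?_ (differentiableAt_retract q)
  rw [retract_coe]
  exact differentiableAt_of_contDiffOn (contDiffOn_ambientGrad hF) q

theorem mink_tangentProj (p : H2) (x : R3) (Z : tangent p) :
    mink (tangentProj p x).1 Z.1 = mink x Z.1 := by
  have hZ : mink p.1 Z.1 = 0 := Z.2
  simp [tangentProj, mink_add_left, mink_smul_left, hZ]

/-- The hyperbolic Hessian of a function in terms of an arbitrary smooth extension. -/
theorem mink_hess (hF : ContDiffOn ℝ ((⊤ : ℕ∞) : WithTop ℕ∞) F futureCone)
    (hu : ∀ q : H2, u q = F q.1) (p : H2) (Y Z : tangent p) :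
    mink (hess u p Y).1 Z.1
      = fderiv ℝ (fderiv ℝ F) p.1 Y.1 Z.1 + mink Y.1 Z.1 * fderiv ℝ F p.1 p.1 := by
  have hY : mink p.1 Y.1 = 0 := Y.2
  have hZ : mink p.1 Z.1 = 0 := Z.2
  have h1 : (hess u p Y) = tangentProj p (fderiv ℝ (radialExt fun q => (grad u q).1) p.1 Y.1) := rfl
  rw [h1, mink_tangentProj, (radialExt_grad_eventuallyEq hF hu p).fderiv_eq, fderiv_comp _
    (by rw [retract_coe]; exact differentiableAt_of_contDiffOn (contDiffOn_ambientGrad hF) p)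
    (differentiableAt_retract p), retract_coe]
  simp only [ContinuousLinearMap.comp_apply, fderiv_retract, hY, zero_smul, add_zero]
  have h2 : minkCLM Z.1 (fderiv ℝ (ambientGrad F) p.1 Y.1)
      = fderiv ℝ (fun x => minkCLM Z.1 (ambientGrad F x)) p.1 Y.1 := by
    exact (((minkCLM Z.1).hasFDerivAt.comp p.1 (differentiableAt_of_contDiffOn
      (contDiffOn_ambientGrad hF) p).hasFDerivAt).fderiv.symm ▸ rfl)
  rw [← minkCLM_apply, h2]
  simp only [minkCLM_apply, mink_ambientGrad]
  have hd := differentiableAt_of_contDiffOn (contDiffOn_fderiv hF) p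
  have hm : HasFDerivAt (fun x => mink x Z.1) (minkCLM Z.1) p.1 := by
    have := (minkCLM Z.1).hasFDerivAt (x := p.1)
    simpa only [funext (minkCLM_apply Z.1)] using this
  -- In the derivative of `dF_x(x) ⟨x,Z⟩` only `dF_p(p) ⟨Y,Z⟩` survives, since `⟨p,Z⟩ = 0`. This is
  -- the contribution of the second fundamental form of the hyperboloid.
  have h3 := (hd.hasFDerivAt.clm_apply (hasFDerivAt_const Z.1 p.1)).add
    ((hd.hasFDerivAt.clm_apply (hasFDerivAt_id p.1)).mul hm)
  have h4 : fderiv ℝ (fun x => fderiv ℝ F x Z.1 + fderiv ℝ F x x * mink x Z.1) p.1 = _ := h3.fderiv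
  rw [h4]
  simp [hZ, minkCLM_apply]
  ring

theorem radialExt_complexJ (V : VField) {x : R3} (hx : x ∈ futureCone) :
    radialExt (fun q => (complexJ q (V q) : R3)) x
      = boxProd (retract x) (radialExt (fun q => (V q : R3)) x) := by
  rw [radialExt_of_mem _ hx, radialExt_of_mem _ hx]
  rfl

/-- The complex structure is parallel. -/
theorem nabla_complexJ (V : VField) (p : H2)
    (hV : DifferentiableAt ℝ (radialExt fun q => (V q : R3)) p.1) (Y : tangent p) :
    nabla (fun q => complexJ q (V q)) p Y = complexJ p (nabla V p Y) := by
  set R := radialExt fun q => (V q : R3) with hR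
  have he : (radialExt fun q => (complexJ q (V q) : R3)) =ᶠ[𝓝 p.1]
      fun x => boxProd (retract x) (R x) := by
    filter_upwards [isOpen_futureCone.mem_nhds (mem_futureCone p)] with x hx
      using radialExt_complexJ V hx
  have hY : mink p.1 Y.1 = 0 := Y.2
  have hN : HasDerivAt (fun t : ℝ => retract (p.1 + t • Y.1)) Y.1 0 := by
    have := HasFDerivAt.comp_hasDerivAt_of_eq 0 (differentiableAt_retract p).hasFDerivAt
      (hasDerivAt_line p.1 Y.1) (by simp)
    simpa [fderiv_retract, hY, Function.comp_def] using this
  have hR' : HasDerivAt (fun t : ℝ => R (p.1 + t • Y.1)) (fderiv ℝ R p.1 Y.1) 0 :=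
    HasFDerivAt.comp_hasDerivAt_of_eq 0 hV.hasFDerivAt (hasDerivAt_line p.1 Y.1) (by simp)
  have hNi := hasDerivAt_pi.1 hN
  have hRi := hasDerivAt_pi.1 hR'
  have hd : DifferentiableAt ℝ (fun x => boxProd (retract x) (R x)) p.1 := by
    have a := differentiableAt_pi.1 (differentiableAt_retract p)
    have b := differentiableAt_pi.1 hV
    rw [differentiableAt_pi]
    intro i
    fin_cases i
    · exact (((a 1).mul (b 2)).sub ((a 2).mul (b 1))).neg
    · exact ((a 2).mul (b 0)).sub ((a 0).mul (b 2))
    · exact ((a 0).mul (b 1)).sub ((a 1).mul (b 0))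
  have hB : fderiv ℝ (fun x => boxProd (retract x) (R x)) p.1 Y.1
      = boxProd Y.1 (V p).1 + boxProd p.1 (fderiv ℝ R p.1 Y.1) := by
    apply fderiv_eq_of_hasDerivAt hd
    have h0 : retract (p.1 + (0 : ℝ) • Y.1) = p.1 := by simp [retract_coe]
    have h00 : R (p.1 + (0 : ℝ) • Y.1) = (V p).1 := by
      rw [zero_smul, add_zero, hR, radialExt_coe]
    rw [hasDerivAt_pi]
    intro i
    fin_cases i
    · refine ((((hNi 1).mul (hRi 2)).sub ((hNi 2).mul (hRi 1))).neg).congr_deriv ?_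
      simp only [h0, h00]
      simp [boxProd, cross_apply]; ring
    · refine ((((hNi 2).mul (hRi 0)).sub ((hNi 0).mul (hRi 2)))).congr_deriv ?_
      simp only [h0, h00]
      simp [boxProd, cross_apply]; ring
    · refine ((((hNi 0).mul (hRi 1)).sub ((hNi 1).mul (hRi 0)))).congr_deriv ?_
      simp only [h0, h00]
      simp [boxProd, cross_apply]; ring
  have hl : nabla (fun q => complexJ q (V q)) p Y = tangentProj p
      (boxProd Y.1 (V p).1 + boxProd p.1 (fderiv ℝ R p.1 Y.1)) := by
    rw [← hB, ← he.fderiv_eq]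
    rfl
  have hr : nabla V p Y = tangentProj p (fderiv ℝ R p.1 Y.1) := rfl
  have hW : mink p.1 (V p).1 = 0 := (V p).2
  rw [hl, hr]
  generalize fderiv ℝ R p.1 Y.1 = D
  generalize (V p).1 = W at hW
  refine eq_of_forall_mink fun Z => ?_
  have hZ : mink p.1 Z.1 = 0 := Z.2
  -- The product rule adds `Y ⊠ V` to `J ∇_Y V`. It is normal to the hyperboloid, because three
  -- vectors of one tangent plane have determinant zero; the factor `p₀` makes this determinant a
  -- combination of the three tangency equations.
  have hdet : mink (boxProd Y.1 W) Z.1 = 0 := by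
    refine (mul_eq_zero.1 (?_ : p.1 0 * mink (boxProd Y.1 W) Z.1 = 0)).resolve_left p.2.2.ne'
    rw [mink_boxProd]
    simp [Matrix.det_fin_three, -mul_eq_zero]
    simp only [mink] at hY hZ hW
    linear_combination (-(W 1 * Z.1 2) + W 2 * Z.1 1) * hY + (Y.1 1 * Z.1 2 - Y.1 2 * Z.1 1) * hW
      + (W 1 * Y.1 2 - W 2 * Y.1 1) * hZ
  rw [mink_tangentProj, mink_add_left, hdet, zero_add]
  simp [complexJ, tangentProj, mink, boxProd, cross_apply]
  ring

theorem laplacian_eq (hF : ContDiffOn ℝ ((⊤ : ℕ∞) : WithTop ℕ∞) F futureCone)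
    (hu : ∀ q : H2, u q = F q.1) (p : H2) :
    laplacian u p = fderiv ℝ (fderiv ℝ F) p.1 (frameFst p).1 (frameFst p).1
      + fderiv ℝ (fderiv ℝ F) p.1 (frameSnd p).1 (frameSnd p).1 + 2 * fderiv ℝ F p.1 p.1 := by
  rw [laplacian, trace_eq_frame, mink_hess hF hu, mink_hess hF hu, mink_frameFst_frameFst,
    mink_frameSnd_frameSnd]
  ring

end extension

/-! ### The maximum principle -/

/-- A positive second derivative along a line would also make the point a local minimum of the
restriction, which would then be locally constant with vanishing second derivative. -/
theorem fderiv_fderiv_nonpos_of_isLocalMax {F : R3 → ℝ}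
    (hF : ContDiffOn ℝ ((⊤ : ℕ∞) : WithTop ℕ∞) F futureCone) (p : H2) (hm : IsLocalMax F p.1)
    (v : R3) : fderiv ℝ (fderiv ℝ F) p.1 v v ≤ 0 := by
  by_contra! hpos
  set g : ℝ → ℝ := fun t => F (p.1 + t • v) with hg
  have hd1 : deriv g =ᶠ[𝓝 0] fun t => fderiv ℝ F (p.1 + t • v) v := by
    filter_upwards [tendsto_line p.1 v (isOpen_futureCone.mem_nhds (mem_futureCone p))] with t ht
    have hl : HasDerivAt (fun t : ℝ => p.1 + t • v) v t := by
      simpa using ((hasDerivAt_id t).smul_const v).const_add p.1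
    exact (HasFDerivAt.comp_hasDerivAt t ((hF.contDiffAt
      (isOpen_futureCone.mem_nhds ht)).differentiableAt (by simp)).hasFDerivAt hl).deriv
  have hd2 : deriv (deriv g) 0 = fderiv ℝ (fderiv ℝ F) p.1 v v := by
    rw [hd1.deriv_eq]
    have h := HasFDerivAt.comp_hasDerivAt_of_eq 0
      (differentiableAt_of_contDiffOn (contDiffOn_fderiv hF) p).hasFDerivAt (hasDerivAt_line p.1 v)
      (by simp)
    simpa using (h.clm_apply (hasDerivAt_const (0 : ℝ) v)).deriv
  have hmax : ∀ᶠ t in 𝓝 (0 : ℝ), g t ≤ g 0 := by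
    have := (tendsto_line p.1 v).eventually hm
    simpa [hg] using this
  have hd0 : deriv g 0 = 0 := IsLocalMax.deriv_eq_zero hmax
  have hc : ContinuousAt g 0 := by
    refine ContinuousAt.comp_of_eq (g := F) (differentiableAt_of_contDiffOn hF p).continuousAt ?_
      (by simp)
    fun_prop
  have hmin := isLocalMin_of_deriv_deriv_pos (hd2 ▸ hpos) hd0 hc
  have hconst : g =ᶠ[𝓝 0] fun _ => g 0 := by
    filter_upwards [hmax, hmin] with t h1 h2 using le_antisymm h1 h2
  have h0 : deriv (deriv g) 0 = 0 := by
    rw [hconst.deriv.deriv_eq]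
    simp
  linarith

theorem laplacian_nonpos_of_isMax {h : H2 → ℝ} (hs : IsSmooth h) (p : H2)
    (hp : ∀ q, h q ≤ h p) : laplacian h p ≤ 0 := by
  have hm : IsLocalMax (radialExt h) p.1 := by
    filter_upwards [isOpen_futureCone.mem_nhds (mem_futureCone p)] with x hx
    rw [radialExt_coe, radialExt_of_mem h hx]
    exact hp _
  rw [laplacian_eq hs (fun q => (radialExt_coe h q).symm), hm.fderiv_eq_zero]
  have h1 := fderiv_fderiv_nonpos_of_isLocalMax hs p hm (frameFst p).1
  have h2 := fderiv_fderiv_nonpos_of_isLocalMax hs p hm (frameSnd p).1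
  simp only [_root_.zero_apply]
  linarith

/-- The coordinate `q₀` solves the equation `Δf = 2f`, whereas a positive constant `c` satisfies `Δc
- 2c < 0`; so `c + M q₀` serves as a strict barrier for a difference of two solutions. -/
theorem laplacian_sub_sub_affine {u₁ u₂ : H2 → ℝ} (h₁ : IsSmooth u₁) (h₂ : IsSmooth u₂)
    (c M : ℝ) (p : H2) :
    IsSmooth (fun q => u₁ q - u₂ q - (c + M * q.1 0)) ∧
    laplacian (fun q => u₁ q - u₂ q - (c + M * q.1 0)) p
      = laplacian u₁ p - laplacian u₂ p - 2 * (M * p.1 0) := by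
  set F : R3 → ℝ := fun x => radialExt u₁ x - radialExt u₂ x - (c + M * x 0) with hFdef
  have hL : ContDiff ℝ ((⊤ : ℕ∞) : WithTop ℕ∞) fun x : R3 => c + M * x 0 := by fun_prop
  have hF : ContDiffOn ℝ ((⊤ : ℕ∞) : WithTop ℕ∞) F futureCone := (h₁.sub h₂).sub hL.contDiffOn
  have hu : ∀ q : H2, u₁ q - u₂ q - (c + M * q.1 0) = F q.1 := by
    intro q
    simp only [hFdef, radialExt_coe]
  have hd : ∀ x ∈ futureCone, fderiv ℝ F x = fderiv ℝ (radialExt u₁) x - fderiv ℝ (radialExt u₂) x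
      - M • ContinuousLinearMap.proj 0 := by
    intro x hx
    have hx' := isOpen_futureCone.mem_nhds hx
    have a1 := ((h₁.contDiffAt hx').differentiableAt (by simp)).hasFDerivAt
    have a2 := ((h₂.contDiffAt hx').differentiableAt (by simp)).hasFDerivAt
    have a3 : HasFDerivAt (fun x : R3 => c + M * x 0)
        (M • (ContinuousLinearMap.proj 0 : R3 →L[ℝ] ℝ)) x :=
      ((ContinuousLinearMap.proj (R := ℝ) (φ := fun _ : Fin 3 => ℝ) 0).hasFDerivAt.const_mul
        M).const_add c
    exact ((a1.sub a2).sub a3).fderiv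
  have hdd : fderiv ℝ (fderiv ℝ F) p.1 = fderiv ℝ (fderiv ℝ (radialExt u₁)) p.1
      - fderiv ℝ (fderiv ℝ (radialExt u₂)) p.1 := by
    have he : fderiv ℝ F =ᶠ[𝓝 p.1] fun x => fderiv ℝ (radialExt u₁) x - fderiv ℝ (radialExt u₂) x
        - M • ContinuousLinearMap.proj 0 := by
      filter_upwards [isOpen_futureCone.mem_nhds (mem_futureCone p)] with x hx using hd x hx
    rw [he.fderiv_eq]
    have a1 := (differentiableAt_of_contDiffOn (contDiffOn_fderiv h₁) p).hasFDerivAt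
    have a2 := (differentiableAt_of_contDiffOn (contDiffOn_fderiv h₂) p).hasFDerivAt
    exact ((a1.sub a2).sub_const _).fderiv
  refine ⟨isSmooth_of_extension hF hu, ?_⟩
  rw [laplacian_eq hF hu, laplacian_eq h₁ (fun q => (radialExt_coe u₁ q).symm),
    laplacian_eq h₂ (fun q => (radialExt_coe u₂ q).symm), hdd, hd _ (mem_futureCone p)]
  simp
  ring

theorem sqrt_one_sub_norm_klein (q : H2) : √(1 - ‖klein q‖ ^ 2) = (q.1 0)⁻¹ := by
  have h := q.2.1
  have h0 := q.2.2
  rw [← Complex.normSq_eq_norm_sq, Complex.normSq_apply]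
  simp only [klein]
  rw [show 1 - (q.1 1 / q.1 0 * (q.1 1 / q.1 0) + q.1 2 / q.1 0 * (q.1 2 / q.1 0))
    = ((q.1 0)⁻¹) ^ 2 by simp only [mink] at h; field_simp; linarith]
  exact Real.sqrt_sq (inv_pos.2 h0).le

theorem lift_klein (q : H2) : (![1, (klein q).re, (klein q).im] : R3) = (q.1 0)⁻¹ • q.1 := by
  have h0 := q.2.2
  ext i
  fin_cases i
  · simp [h0.ne']
  · simp [klein]; field_simp
  · simp [klein]; field_simp

theorem klein_mem_ball (q : H2) : klein q ∈ Metric.ball (0 : ℂ) 1 := by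
  have h := sqrt_one_sub_norm_klein q
  have h1 : 0 < 1 - ‖klein q‖ ^ 2 := Real.sqrt_pos.1 (h ▸ inv_pos.2 q.2.2)
  rw [mem_ball_zero_iff]
  nlinarith [norm_nonneg (klein q)]

/-- If `u₁ - u₂` exceeded `ε` somewhere, then `(u₁ - u₂ - ε) / q₀` would have a positive maximum `M`
on the disk, since it tends to 0 at the circle. At a maximum point the nonpositive function `h = u₁
- u₂ - (ε + M q₀)` vanishes, so `Δh ≤ 0`; but there the equation gives `Δh = 2ε`. -/
theorem IsMeanSurface.le {φ : Circle → ℝ} {u₁ u₂ : H2 → ℝ} (h₁ : IsMeanSurface φ u₁)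
    (h₂ : IsMeanSurface φ u₂) (q : H2) : u₁ q ≤ u₂ q := by
  by_contra! hlt
  set ε := (u₁ q - u₂ q) / 2 with hε
  have hε0 : 0 < ε := by linarith
  -- Defined on the whole plane: outside the open disk the square root of a nonpositive number is 0,
  -- so `g` vanishes there, which matches the boundary limit.
  set g : ℂ → ℝ := fun η => √(1 - ‖η‖ ^ 2) *
    (radialExt u₁ ![1, η.re, η.im] - radialExt u₂ ![1, η.re, η.im] - ε) with hg
  have hg0 : ∀ η : ℂ, η ∉ Metric.ball (0 : ℂ) 1 → g η = 0 := by
    intro η hη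
    rw [mem_ball_zero_iff, not_lt] at hη
    simp only [hg]
    rw [Real.sqrt_eq_zero_of_nonpos (by nlinarith), zero_mul]
  have hgb : ∀ η : Metric.ball (0 : ℂ) 1,
      g η = ubar u₁ η - ubar u₂ η - √(1 - ‖η.1‖ ^ 2) * ε := by
    intro η
    simp only [hg, ubar, kleinInv, radialExt_of_mem _ (one_eta_mem η.2)]
    ring
  have hgk : ∀ q : H2, g (klein q) = (q.1 0)⁻¹ * (u₁ q - u₂ q - ε) := by
    intro q
    simp only [hg, sqrt_one_sub_norm_klein, lift_klein, radialExt_smul_coe _ (inv_pos.2 q.2.2)]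
  have hcont : ContinuousOn g (Metric.closedBall 0 1) := by
    intro η hη
    refine ContinuousAt.continuousWithinAt ?_
    by_cases hb : η ∈ Metric.ball (0 : ℂ) 1
    · have hl : ContinuousAt (fun η : ℂ => (![1, η.re, η.im] : R3)) η := by
        refine continuousAt_pi.2 fun i => ?_
        fin_cases i
        · exact continuousAt_const
        · exact Complex.continuous_re.continuousAt
        · exact Complex.continuous_im.continuousAt
      have hn := isOpen_futureCone.mem_nhds (one_eta_mem hb)
      have a1 : ContinuousAt (fun η : ℂ => radialExt u₁ ![1, η.re, η.im]) η :=
        ContinuousAt.comp (g := radialExt u₁) (f := fun η : ℂ => ![1, η.re, η.im])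
          (h₁.smooth.contDiffAt hn).continuousAt hl
      have a2 : ContinuousAt (fun η : ℂ => radialExt u₂ ![1, η.re, η.im]) η :=
        ContinuousAt.comp (g := radialExt u₂) (f := fun η : ℂ => ![1, η.re, η.im])
          (h₂.smooth.contDiffAt hn).continuousAt hl
      have a3 : ContinuousAt (fun η : ℂ => √(1 - ‖η‖ ^ 2)) η := by fun_prop
      exact a3.mul ((a1.sub a2).sub continuousAt_const)
    · have hη1 : ‖η‖ = 1 := by
        rw [mem_closedBall_zero_iff] at hη
        rw [mem_ball_zero_iff, not_lt] at hb
        exact le_antisymm hη hb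
      let z : Circle := ⟨η, mem_sphere_zero_iff_norm.2 hη1⟩
      have ht : Tendsto (fun ζ : Metric.ball (0 : ℂ) 1 =>
          ubar u₁ ζ - ubar u₂ ζ - √(1 - ‖ζ.1‖ ^ 2) * ε) (comap Subtype.val (𝓝 η)) (𝓝 0) := by
        have a1 := h₁.boundary z
        have a2 := h₂.boundary z
        have a3 : Tendsto (fun ζ : ℂ => √(1 - ‖ζ‖ ^ 2) * ε) (𝓝 η) (𝓝 0) := by
          have : Continuous fun ζ : ℂ => √(1 - ‖ζ‖ ^ 2) * ε := by fun_prop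
          simpa [hη1] using this.tendsto η
        have := (a1.sub a2).sub (a3.comp tendsto_comap)
        simpa using this
      rw [ContinuousAt, hg0 η hb]
      intro s hs
      rw [Filter.mem_map]
      obtain ⟨t, ht1, ht2⟩ := mem_comap.1 (ht hs)
      filter_upwards [ht1] with ζ hζ
      by_cases hζb : ζ ∈ Metric.ball (0 : ℂ) 1
      · have := @ht2 ⟨ζ, hζb⟩ hζ
        rwa [mem_preimage, ← hgb] at this
      · rw [mem_preimage, hg0 ζ hζb]
        exact mem_of_mem_nhds hs
  obtain ⟨η, hη, hmax⟩ := (isCompact_closedBall (0 : ℂ) 1).exists_isMaxOn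
    ⟨0, by simp⟩ hcont
  have hle : ∀ q : H2, g (klein q) ≤ g η := fun q =>
    hmax (Metric.ball_subset_closedBall (klein_mem_ball q))
  have hpos : 0 < g η := by
    refine lt_of_lt_of_le ?_ (hle q)
    rw [hgk]
    exact mul_pos (inv_pos.2 q.2.2) (by linarith)
  have hb : η ∈ Metric.ball (0 : ℂ) 1 := by
    by_contra hb
    rw [hg0 η hb] at hpos
    exact lt_irrefl _ hpos
  set p := kleinInv ⟨η, hb⟩ with hp
  have hkp : klein p = η := klein_kleinInv ⟨η, hb⟩
  obtain ⟨hs, hl⟩ := laplacian_sub_sub_affine h₁.smooth h₂.smooth ε (g η) p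
  have hval : ∀ q : H2, u₁ q - u₂ q - (ε + g η * q.1 0) = q.1 0 * (g (klein q) - g η) := by
    intro q
    have := q.2.2
    rw [hgk]
    field_simp
    ring
  have hneg := laplacian_nonpos_of_isMax hs p fun q => by
    rw [hval, hval, hkp, sub_self, mul_zero]
    exact mul_nonpos_of_nonneg_of_nonpos q.2.2.le (sub_nonpos.2 (hle q))
  have hv := hval p
  rw [hkp, sub_self, mul_zero] at hv
  have m1 := h₁.mean p
  have m2 := h₂.mean p
  rw [hl] at hneg
  linarith

/-! ### Further properties of the kernel integrals -/

theorem kerInt_mono {ψ₁ ψ₂ : ℝ → ℝ} (h₁ : Continuous ψ₁) (h₂ : Continuous ψ₂) {x : R3}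
    (hx : x ∈ futureCone) {j k : ℕ}
    (h : ∀ θ, ψ₁ θ * (nullForm θ x)⁻¹ ^ j ≤ ψ₂ θ * (nullForm θ x)⁻¹ ^ k) :
    kerInt ψ₁ j x ≤ kerInt ψ₂ k x :=
  intervalIntegral.integral_mono_on (by positivity)
    ((continuous_kernel h₁ j hx).intervalIntegrable _ _)
    ((continuous_kernel h₂ k hx).intervalIntegrable _ _) fun θ _ => h θ

theorem kerInt_mono_left {ψ₁ ψ₂ : ℝ → ℝ} (h₁ : Continuous ψ₁) (h₂ : Continuous ψ₂) {x : R3}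
    (hx : x ∈ futureCone) (k : ℕ) (h : ∀ θ, ψ₁ θ ≤ ψ₂ θ) : kerInt ψ₁ k x ≤ kerInt ψ₂ k x :=
  kerInt_mono h₁ h₂ hx fun θ =>
    mul_le_mul_of_nonneg_right (h θ) (pow_nonneg (inv_nonneg.2 (nullForm_pos hx θ).le) k)

theorem kerInt_congr {ψ₁ ψ₂ : ℝ → ℝ} {x : R3} {j k : ℕ}
    (h : ∀ θ, ψ₁ θ * (nullForm θ x)⁻¹ ^ j = ψ₂ θ * (nullForm θ x)⁻¹ ^ k) :
    kerInt ψ₁ j x = kerInt ψ₂ k x :=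
  intervalIntegral.integral_congr fun θ _ => h θ

theorem kerInt_const_mul (c : ℝ) (ψ : ℝ → ℝ) (k : ℕ) (x : R3) :
    kerInt (fun θ => c * ψ θ) k x = c * kerInt ψ k x := by
  simp only [kerInt, mul_assoc, intervalIntegral.integral_const_mul]

theorem kerInt_sub {ψ₁ ψ₂ : ℝ → ℝ} (h₁ : Continuous ψ₁) (h₂ : Continuous ψ₂) {x : R3}
    (hx : x ∈ futureCone) (k : ℕ) :
    kerInt (fun θ => ψ₁ θ - ψ₂ θ) k x = kerInt ψ₁ k x - kerInt ψ₂ k x := by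
  simp only [kerInt, sub_mul]
  exact intervalIntegral.integral_sub ((continuous_kernel h₁ k hx).intervalIntegrable _ _)
    ((continuous_kernel h₂ k hx).intervalIntegrable _ _)

theorem continuous_nullForm_apply (v : R3) : Continuous fun θ => nullForm θ v :=
  continuous_nullForm.clm_apply continuous_const

theorem fderiv_fderiv_kerInt {ψ : ℝ → ℝ} (hψ : Continuous ψ) (p : H2) (Y Z : R3) :
    fderiv ℝ (fderiv ℝ (kerInt ψ 2)) p.1 Y Z
      = 6 * kerInt (fun θ => ψ θ * (nullForm θ Y * nullForm θ Z)) 4 p.1 := by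
  have hp := mem_futureCone p
  have hd := differentiableAt_of_contDiffOn (contDiffOn_fderiv (contDiffOn_kerInt hψ 2)) p
  have h1 : fderiv ℝ (fderiv ℝ (kerInt ψ 2)) p.1 Y Z
      = fderiv ℝ (fun x => fderiv ℝ (kerInt ψ 2) x Z) p.1 Y := by
    have h := (hd.hasFDerivAt.clm_apply (hasFDerivAt_const Z p.1)).fderiv
    rw [h]
    simp
  have h2 : (fun x => fderiv ℝ (kerInt ψ 2) x Z) =ᶠ[𝓝 p.1]
      kerInt (fun θ => -(2 : ℕ) * (ψ θ * nullForm θ Z)) 3 := by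
    filter_upwards [isOpen_futureCone.mem_nhds hp] with x hx using fderiv_kerInt hψ 2 hx Z
  have hc : Continuous fun θ => -((2 : ℕ) : ℝ) * (ψ θ * nullForm θ Z) :=
    continuous_const.mul (hψ.mul (continuous_nullForm_apply Z))
  rw [h1, h2.fderiv_eq, fderiv_kerInt hc 3 hp, ← kerInt_const_mul]
  refine kerInt_congr fun θ => ?_
  push_cast
  ring

/-- Euler's identity for a function homogeneous of degree `-2`. -/
theorem fderiv_kerInt_self {ψ : ℝ → ℝ} (hψ : Continuous ψ) (p : H2) :
    fderiv ℝ (kerInt ψ 2) p.1 p.1 = -2 * kerInt ψ 2 p.1 := by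
  rw [fderiv_kerInt hψ 2 (mem_futureCone p), ← kerInt_const_mul]
  refine kerInt_congr fun θ => ?_
  have := (nullForm_pos (mem_futureCone p) θ).ne'
  push_cast
  field_simp

theorem nullForm_eq_mink (θ : ℝ) (x : R3) : nullForm θ x = -mink x ![1, cos θ, sin θ] := by
  simp [nullForm_apply, mink]
  ring

theorem mink_null (θ : ℝ) : mink ![1, cos θ, sin θ] ![1, cos θ, sin θ] = 0 := by
  simp [mink]
  linear_combination sin_sq_add_cos_sq θ

theorem coe_complexJ {p : H2} (Y : tangent p) : (complexJ p Y).1 = boxProd p.1 Y.1 := rfl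

/-- The squared determinant is minus the Lorentzian Gram determinant of the three vectors. -/
theorem mink_boxProd_sq (x y v : R3) : mink (boxProd x y) v ^ 2 =
    -(mink x x * (mink y y * mink v v - mink y v ^ 2)
      - mink x y * (mink x y * mink v v - mink y v * mink x v)
      + mink x v * (mink x y * mink y v - mink y y * mink x v)) := by
  rw [mink_boxProd]
  simp only [mink, Matrix.det_fin_three, Matrix.of_apply, Matrix.cons_val_zero,
    Matrix.cons_val_one, Matrix.cons_val]
  ring

/-- Parseval for a null vector `n` in the orthogonal frame `p, Y, JY`: since `⟨n,n⟩ = 0`, the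
tangential part of `n` is as long as its component along `p`. -/
theorem nullForm_sq_add_sq {p : H2} (θ : ℝ) (Y : tangent p) :
    nullForm θ Y.1 ^ 2 + nullForm θ (complexJ p Y).1 ^ 2 = nullForm θ p.1 ^ 2 * mink Y.1 Y.1 := by
  have hY : mink p.1 Y.1 = 0 := Y.2
  simp only [nullForm_eq_mink, neg_sq, coe_complexJ, mink_boxProd_sq, mink_null, hY, p.2.1]
  ring

theorem mink_complexJ_complexJ {p : H2} (Y Z : tangent p) :
    mink (complexJ p Y).1 (complexJ p Z).1 = mink Y.1 Z.1 := by
  have hY : mink p.1 Y.1 = 0 := Y.2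
  have hZ : mink p.1 Z.1 = 0 := Z.2
  have hp := p.2.1
  have key : ∀ x y z : R3, mink (boxProd x y) (boxProd x z)
      = mink x z * mink x y - mink x x * mink y z := by
    intro x y z
    simp [mink, boxProd, cross_apply]
    ring
  rw [coe_complexJ, coe_complexJ, key, hY, hZ, hp]
  ring

theorem complexJ_complexJ {p : H2} (Y : tangent p) : complexJ p (complexJ p Y) = -Y := by
  refine eq_of_forall_mink fun Z => ?_
  have hY : mink p.1 Y.1 = 0 := Y.2
  have hZ : mink p.1 Z.1 = 0 := Z.2
  have key : ∀ x y z : R3, mink (boxProd x (boxProd x y)) z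
      = mink x x * mink y z - mink x y * mink x z := by
    intro x y z
    simp [mink, boxProd, cross_apply]
    ring
  rw [coe_complexJ, coe_complexJ, key, hY, p.2.1]
  simp [mink]
  ring

theorem mink_self_nonneg {p : H2} (Y : tangent p) : 0 ≤ mink Y.1 Y.1 := by
  have := mink_eq_frame Y.1 Y
  rw [mink_comm (frameFst p).1, mink_comm (frameSnd p).1] at this
  nlinarith [mul_self_nonneg (mink Y.1 (frameFst p).1), mul_self_nonneg (mink Y.1 (frameSnd p).1)]

theorem hnorm_sq {p : H2} (Y : tangent p) : hnorm Y ^ 2 = mink Y.1 Y.1 :=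
  Real.sq_sqrt (mink_self_nonneg Y)

theorem hnorm_nonneg {p : H2} (Y : tangent p) : 0 ≤ hnorm Y := Real.sqrt_nonneg _

theorem hnorm_complexJ {p : H2} (Y : tangent p) : hnorm (complexJ p Y) = hnorm Y := by
  rw [hnorm, hnorm, mink_complexJ_complexJ]

/-- Cauchy–Schwarz for the plane vectors `(ℓ(Y), ℓ(JY))` and `(ℓ(Z), -ℓ(JZ))`, whose lengths are
`ℓ(p)|Y|` and `ℓ(p)|Z|`. -/
theorem nullForm_mul_sub_mul_le {p : H2} (θ : ℝ) (Y Z : tangent p) :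
    nullForm θ Y.1 * nullForm θ Z.1 - nullForm θ (complexJ p Y).1 * nullForm θ (complexJ p Z).1
      ≤ nullForm θ p.1 ^ 2 * (hnorm Y * hnorm Z) := by
  have hl := nullForm_pos (mem_futureCone p) θ
  refine le_of_abs_le (abs_le_of_sq_le_sq ?_
    (mul_nonneg (sq_nonneg _) (mul_nonneg (hnorm_nonneg Y) (hnorm_nonneg Z))))
  have h : (nullForm θ p.1 ^ 2 * (hnorm Y * hnorm Z)) ^ 2
      = (nullForm θ p.1 ^ 2 * hnorm Y ^ 2) * (nullForm θ p.1 ^ 2 * hnorm Z ^ 2) := by ring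
  rw [h, hnorm_sq, hnorm_sq, ← nullForm_sq_add_sq, ← nullForm_sq_add_sq]
  nlinarith [sq_nonneg (nullForm θ Y.1 * nullForm θ (complexJ p Z).1
    + nullForm θ (complexJ p Y).1 * nullForm θ Z.1)]

/-! ### The solution of the mean surface equation -/

/-- The integral formula for the solution with boundary value `φ`. -/
def potential (φ : Circle → ℝ) (q : H2) : ℝ :=
  kerInt (fun θ => (2 * π)⁻¹ * φ (Circle.exp θ)) 2 q.1

theorem continuous_density {φ : Circle → ℝ} (hφ : Continuous φ) :
    Continuous fun θ => (2 * π)⁻¹ * φ (Circle.exp θ) :=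
  continuous_const.mul (hφ.comp Circle.exp.continuous)

theorem affineMap_apply (a : ℂ →ᵃ[ℝ] ℝ) (ζ : ℂ) :
    a ζ = a 0 + ζ.re * a.linear 1 + ζ.im * a.linear Complex.I := by
  have h1 := a.map_vadd 0 ζ
  have h2 : ζ = ζ.re • (1 : ℂ) + ζ.im • Complex.I := by
    apply Complex.ext <;> simp
  simp only [vadd_eq_add, add_zero] at h1
  rw [h1]
  conv_lhs => rw [h2]
  rw [map_add, map_smul, map_smul]
  simp only [smul_eq_mul]
  ring

/-- On the circle an affine function is `θ ↦ ℓ_θ(v)` for a fixed vector `v`, so `kerInt_linear`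
evaluates the integral. -/
theorem potential_affine (a : ℂ →ᵃ[ℝ] ℝ) (q : H2) :
    potential (fun z => a z) q = q.1 0 * a (klein q) := by
  have h0 := q.2.2.ne'
  have h1 : ∀ θ, a (Circle.exp θ) = nullForm θ ![a 0, -a.linear 1, -a.linear Complex.I] := by
    intro θ
    rw [affineMap_apply, nullForm_apply, Circle.coe_exp, Complex.exp_ofReal_mul_I_re,
      Complex.exp_ofReal_mul_I_im]
    simp
  simp only [potential, h1]
  rw [kerInt_const_mul, kerInt_linear, affineMap_apply a (klein q)]
  simp [mink, klein]
  field_simp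
  ring

theorem potential_mono {φ₁ φ₂ : Circle → ℝ} (h₁ : Continuous φ₁) (h₂ : Continuous φ₂)
    (h : ∀ z, φ₁ z ≤ φ₂ z) (q : H2) : potential φ₁ q ≤ potential φ₂ q :=
  kerInt_mono_left (continuous_density h₁) (continuous_density h₂) (mem_futureCone q) 2
    fun θ => mul_le_mul_of_nonneg_left (h _) (by positivity)

theorem continuous_affineMap_circle (a : ℂ →ᵃ[ℝ] ℝ) : Continuous fun z : Circle => a (z : ℂ) :=
  a.continuous_of_finiteDimensional.comp continuous_subtype_val

theorem isSmooth_potential {φ : Circle → ℝ} (hφ : Continuous φ) : IsSmooth (potential φ) :=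
  isSmooth_of_extension (contDiffOn_kerInt (continuous_density hφ) 2) fun _ => rfl

theorem mink_hess_potential {φ : Circle → ℝ} (hφ : Continuous φ) (p : H2) (Y Z : tangent p) :
    mink (hess (potential φ) p Y).1 Z.1
      = 6 * kerInt (fun θ => (2 * π)⁻¹ * φ (Circle.exp θ) * (nullForm θ Y.1 * nullForm θ Z.1)) 4 p.1
        - 2 * (mink Y.1 Z.1 * potential φ p) := by
  have hc := continuous_density hφ
  rw [mink_hess (u := potential φ) (contDiffOn_kerInt hc 2) (fun _ => rfl), fderiv_fderiv_kerInt hc,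
    fderiv_kerInt_self hc, potential]
  ring

theorem nullForm_frame (p : H2) (θ : ℝ) :
    nullForm θ (frameFst p).1 ^ 2 + nullForm θ (frameSnd p).1 ^ 2 = nullForm θ p.1 ^ 2 := by
  have h := mink_tangentProj p ![1, cos θ, sin θ] (tangentProj p ![1, cos θ, sin θ])
  rw [mink_eq_frame] at h
  simp only [nullForm_eq_mink, neg_sq]
  have h1 := mink_tangentProj p ![1, cos θ, sin θ] (frameFst p)
  have h2 := mink_tangentProj p ![1, cos θ, sin θ] (frameSnd p)
  have h3 : mink ![1, cos θ, sin θ] (tangentProj p ![1, cos θ, sin θ]).1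
      = mink p.1 ![1, cos θ, sin θ] ^ 2 := by
    rw [mink_comm]
    simp only [tangentProj, LinearMap.coe_mk, AddHom.coe_mk, mink_add_left, mink_smul_left,
      mink_null]
    ring
  rw [h3, mink_comm (frameFst p).1 (tangentProj p _).1, mink_comm (frameSnd p).1 (tangentProj p _).1,
    h1, h2] at h
  rw [mink_comm (frameFst p).1, mink_comm (frameSnd p).1]
  linarith

/-- By `nullForm_frame` the trace of the fourth-power kernel collapses to the square kernel, so the
Laplacian is `6u - 4u`. -/
theorem laplacian_potential {φ : Circle → ℝ} (hφ : Continuous φ) (p : H2) :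
    laplacian (potential φ) p = 2 * potential φ p := by
  have hc := continuous_density hφ
  have hp := mem_futureCone p
  rw [laplacian, trace_eq_frame, mink_hess_potential hφ, mink_hess_potential hφ,
    mink_frameFst_frameFst, mink_frameSnd_frameSnd]
  have h : kerInt (fun θ => (2 * π)⁻¹ * φ (Circle.exp θ) *
        (nullForm θ (frameFst p).1 * nullForm θ (frameFst p).1)) 4 p.1
      = potential φ p - kerInt (fun θ => (2 * π)⁻¹ * φ (Circle.exp θ) *
        (nullForm θ (frameSnd p).1 * nullForm θ (frameSnd p).1)) 4 p.1 := by
    have e : potential φ p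
        = kerInt (fun θ => (2 * π)⁻¹ * φ (Circle.exp θ) * nullForm θ p.1 ^ 2) 4 p.1 := by
      refine kerInt_congr fun θ => ?_
      have := (nullForm_pos hp θ).ne'
      field_simp
    rw [e, ← kerInt_sub _ _ hp]
    · refine kerInt_congr fun θ => ?_
      rw [← nullForm_frame]
      ring
    · exact hc.mul ((continuous_nullForm_apply _).pow 2)
    · exact hc.mul ((continuous_nullForm_apply _).mul (continuous_nullForm_apply _))
  rw [h]
  ring

/-! ### Affine barriers and boundary values -/

theorem exists_affine_ge {φ : Circle → ℝ} (hφ : Continuous φ) (z : Circle) {ε : ℝ} (hε : 0 < ε) :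
    ∃ b : ℂ →ᵃ[ℝ] ℝ, (∀ w : Circle, φ w ≤ b w) ∧ b z = φ z + ε := by
  obtain ⟨δ, hδ, hd⟩ := Metric.continuous_iff.1 hφ z ε hε
  obtain ⟨K, hK⟩ := (isCompact_range hφ).isBounded.exists_norm_le
  have hK' : ∀ w, |φ w| ≤ K := fun w => hK _ (mem_range_self w)
  have hK0 : 0 ≤ K := (abs_nonneg _).trans (hK' z)
  let L : ℂ →ₗ[ℝ] ℝ := (z : ℂ).re • Complex.reLm + (z : ℂ).im • Complex.imLm
  -- The barrier is `φ z + ε + C (1 - ⟨z,w⟩)`, and `1 - ⟨z,w⟩ = |w - z|² / 2` on the circle. Where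
  -- `|w - z| ≥ δ` the last term is at least `2K`, the largest possible oscillation of `φ`.
  let C := 4 * K / δ ^ 2
  have hC : 0 ≤ C := by positivity
  have hz : (z : ℂ).re * (z : ℂ).re + (z : ℂ).im * (z : ℂ).im = 1 := by
    rw [← Complex.normSq_apply]; exact Circle.normSq_coe z
  have hb : ∀ w : ℂ, (AffineMap.const ℝ ℂ (φ z + ε + C) - C • L.toAffineMap) w
      = φ z + ε + C * (1 - ((z : ℂ).re * w.re + (z : ℂ).im * w.im)) := by
    intro w
    simp [L]
    ring
  refine ⟨AffineMap.const ℝ ℂ (φ z + ε + C) - C • L.toAffineMap, fun w => ?_, ?_⟩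
  · rw [hb]
    have hw : (w : ℂ).re * (w : ℂ).re + (w : ℂ).im * (w : ℂ).im = 1 := by
      rw [← Complex.normSq_apply]; exact Circle.normSq_coe w
    have hdist : dist w z ^ 2 = 2 * (1 - ((z : ℂ).re * (w : ℂ).re + (z : ℂ).im * (w : ℂ).im)) := by
      change dist (w : ℂ) (z : ℂ) ^ 2 = _
      rw [dist_eq_norm, ← Complex.normSq_eq_norm_sq, Complex.normSq_apply]
      simp only [Complex.sub_re, Complex.sub_im]
      linear_combination hw + hz
    have hr : 1 - ((z : ℂ).re * (w : ℂ).re + (z : ℂ).im * (w : ℂ).im) = dist w z ^ 2 / 2 := by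
      linarith
    rw [hr]
    rcases lt_or_ge (dist w z) δ with h | h
    · have h1 := hd w h
      rw [Real.dist_eq] at h1
      have := (abs_lt.1 h1).2
      have : 0 ≤ C * (dist w z ^ 2 / 2) := by positivity
      linarith
    · have h1 : C * (δ ^ 2 / 2) = 2 * K := by simp only [C]; field_simp; ring
      have h2 : C * (δ ^ 2 / 2) ≤ C * (dist w z ^ 2 / 2) := by gcongr
      have h3 := (abs_le.1 (hK' w)).2
      have h4 := (abs_le.1 (hK' z)).1
      linarith
  · rw [hb, hz]
    ring

theorem exists_affine_le {φ : Circle → ℝ} (hφ : Continuous φ) (z : Circle) {ε : ℝ} (hε : 0 < ε) :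
    ∃ a : ℂ →ᵃ[ℝ] ℝ, (∀ w : Circle, a w ≤ φ w) ∧ a z = φ z - ε := by
  obtain ⟨b, hb, hbz⟩ := exists_affine_ge hφ.neg z hε
  refine ⟨-b, fun w => ?_, ?_⟩
  · have := hb w
    simp only [Pi.neg_apply, AffineMap.coe_neg] at this ⊢
    linarith
  · simp only [Pi.neg_apply, AffineMap.coe_neg, hbz]
    ring

theorem ubar_eq (u : H2 → ℝ) (η : Metric.ball (0 : ℂ) 1) :
    ubar u η = ((kleinInv η).1 0)⁻¹ * u (kleinInv η) := by
  rw [ubar, ← sqrt_one_sub_norm_klein, klein_kleinInv]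

theorem potential_le_of_affine {φ : Circle → ℝ} (hφ : Continuous φ) {b : ℂ →ᵃ[ℝ] ℝ}
    (hb : ∀ w : Circle, φ w ≤ b w) (q : H2) : potential φ q ≤ q.1 0 * b (klein q) :=
  (potential_mono hφ (continuous_affineMap_circle b) hb q).trans_eq (potential_affine b q)

theorem le_potential_of_affine {φ : Circle → ℝ} (hφ : Continuous φ) {a : ℂ →ᵃ[ℝ] ℝ}
    (ha : ∀ w : Circle, a w ≤ φ w) (q : H2) : q.1 0 * a (klein q) ≤ potential φ q :=
  (potential_affine a q).symm.trans_le (potential_mono (continuous_affineMap_circle a) hφ ha q)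

theorem isMeanSurface_potential {φ : Circle → ℝ} (hφ : Continuous φ) :
    IsMeanSurface φ (potential φ) where
  smooth := isSmooth_potential hφ
  mean p := sub_eq_zero.2 (laplacian_potential hφ p)
  boundary z := by
    rw [tendsto_order]
    constructor
    · intro c hc
      obtain ⟨a, ha, haz⟩ := exists_affine_le hφ z (half_pos (sub_pos.2 hc))
      have hev : ∀ᶠ η in 𝓝 (z : ℂ), c < a η :=
        a.continuous_of_finiteDimensional.tendsto _ (lt_mem_nhds (by linarith))
      filter_upwards [tendsto_comap.eventually hev] with η hη
      have h0 := (kleinInv η).2.2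
      have h := le_potential_of_affine hφ ha (kleinInv η)
      rw [klein_kleinInv] at h
      rw [ubar_eq, inv_mul_eq_div, lt_div_iff₀ h0]
      nlinarith
    · intro c hc
      obtain ⟨b, hb, hbz⟩ := exists_affine_ge hφ z (half_pos (sub_pos.2 hc))
      have hev : ∀ᶠ η in 𝓝 (z : ℂ), b η < c :=
        b.continuous_of_finiteDimensional.tendsto _ (gt_mem_nhds (by linarith))
      filter_upwards [tendsto_comap.eventually hev] with η hη
      have h0 := (kleinInv η).2.2
      have h := potential_le_of_affine hφ hb (kleinInv η)
      rw [klein_kleinInv] at h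
      rw [ubar_eq, inv_mul_eq_div, div_lt_iff₀ h0]
      nlinarith

theorem IsMeanSurface.eq {φ : Circle → ℝ} {u₁ u₂ : H2 → ℝ} (h₁ : IsMeanSurface φ u₁)
    (h₂ : IsMeanSurface φ u₂) : u₁ = u₂ :=
  funext fun q => le_antisymm (h₁.le h₂ q) (h₂.le h₁ q)

theorem meanFn_eq_potential {X : Circle → ℂ} (hc : Continuous (supportFn X)) :
    meanFn X = potential (supportFn X) := by
  have h : ∃ u, IsMeanSurface (supportFn X) u := ⟨_, isMeanSurface_potential hc⟩
  rw [meanFn, dif_pos h]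
  exact h.choose_spec.eq (isMeanSurface_potential hc)

/-! ### The estimate -/

theorem mink_hess_sub_hess_complexJ {φ : Circle → ℝ} (hφ : Continuous φ) (p : H2)
    (Y Z : tangent p) :
    mink (hess (potential φ) p Y).1 Z.1
        - mink (hess (potential φ) p (complexJ p Y)).1 (complexJ p Z).1
      = 6 * kerInt (fun θ => (2 * π)⁻¹ * φ (Circle.exp θ) * (nullForm θ Y.1 * nullForm θ Z.1
        - nullForm θ (complexJ p Y).1 * nullForm θ (complexJ p Z).1)) 4 p.1 := by
  have hc := continuous_density hφ
  have hl := continuous_nullForm_apply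
  rw [mink_hess_potential hφ, mink_hess_potential hφ, mink_complexJ_complexJ]
  simp only [mul_sub]
  rw [kerInt_sub _ _ (mem_futureCone p) 4]
  · ring
  · exact hc.mul ((hl _).mul (hl _))
  · exact hc.mul ((hl _).mul (hl _))

/-- Here the potential is the restriction of a linear form on Minkowski space, so its Hessian is a
multiple of the identity, and `J` is an isometry. -/
theorem mink_hess_sub_hess_complexJ_affine (a : ℂ →ᵃ[ℝ] ℝ) (p : H2) (Y Z : tangent p) :
    mink (hess (potential fun z => a z) p Y).1 Z.1
      = mink (hess (potential fun z => a z) p (complexJ p Y)).1 (complexJ p Z).1 := by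
  set L : R3 →L[ℝ] ℝ := minkCLM ![-a 0, a.linear 1, a.linear Complex.I] with hL
  have hu : ∀ q : H2, potential (fun z => a z) q = L q.1 := by
    intro q
    have := q.2.2.ne'
    rw [potential_affine, affineMap_apply a (klein q), hL, minkCLM_apply]
    simp [mink, klein]
    field_simp
  have hF : ContDiffOn ℝ ((⊤ : ℕ∞) : WithTop ℕ∞) L futureCone := L.contDiff.contDiffOn
  have hc : fderiv ℝ L = fun _ => L := funext fun x => L.fderiv
  rw [mink_hess hF hu, mink_hess hF hu, hc, mink_complexJ_complexJ]
  simp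

theorem mink_hess_sub_hess_complexJ_le {φ : Circle → ℝ} (hφ : Continuous φ) {a : ℂ →ᵃ[ℝ] ℝ}
    (ha : ∀ w : Circle, a w ≤ φ w) (p : H2) (Y Z : tangent p) :
    mink (hess (potential φ) p Y).1 Z.1
        - mink (hess (potential φ) p (complexJ p Y)).1 (complexJ p Z).1
      ≤ 6 * (hnorm Y * hnorm Z * (potential φ p - p.1 0 * a (klein p))) := by
  have hp := mem_futureCone p
  have hac := continuous_affineMap_circle a
  have hl := continuous_nullForm_apply
  have h0 := mink_hess_sub_hess_complexJ hac p Y Z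
  rw [mink_hess_sub_hess_complexJ_affine, sub_self] at h0
  have hk : Continuous fun θ => nullForm θ Y.1 * nullForm θ Z.1
        - nullForm θ (complexJ p Y).1 * nullForm θ (complexJ p Z).1 :=
    ((hl _).mul (hl _)).sub ((hl _).mul (hl _))
  -- The subtracted term is the vanishing integral for `a`, which makes the density `φ - a ≥ 0` and
  -- allows the pointwise kernel bound.
  have h1 : ∀ t : ℝ, t = t - _ := fun t => (sub_zero t).symm.trans (congrArg (t - ·) h0)
  rw [mink_hess_sub_hess_complexJ hφ, h1 (6 * kerInt _ 4 p.1), ← mul_sub,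
    ← kerInt_sub ?_ ?_ hp, ← potential_affine, potential, potential,
    ← kerInt_sub (continuous_density hφ) (continuous_density hac) hp,
    ← kerInt_const_mul (hnorm Y * hnorm Z)]
  rotate_left
  · exact (continuous_density hφ).mul hk
  · exact (continuous_density hac).mul hk
  refine mul_le_mul_of_nonneg_left (kerInt_mono ?_ ?_ hp fun θ => ?_) (by norm_num)
  · exact ((continuous_density hφ).mul hk).sub ((continuous_density hac).mul hk)
  · exact continuous_const.mul ((continuous_density hφ).sub (continuous_density hac))
  · have hpos := nullForm_pos hp θ
    have hb := nullForm_mul_sub_mul_le θ Y Z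
    have hd : 0 ≤ (2 * π)⁻¹ * (φ (Circle.exp θ) - a (Circle.exp θ)) :=
      mul_nonneg (by positivity) (sub_nonneg.2 (ha _))
    have := mul_le_mul_of_nonneg_left hb
      (mul_nonneg hd (pow_nonneg (inv_nonneg.2 hpos.le) 4))
    have e : (nullForm θ p.1)⁻¹ ^ 4 * nullForm θ p.1 ^ 2 = (nullForm θ p.1)⁻¹ ^ 2 := by
      field_simp
    calc _ = (2 * π)⁻¹ * (φ (Circle.exp θ) - a (Circle.exp θ)) * (nullForm θ p.1)⁻¹ ^ 4 *
          (nullForm θ Y.1 * nullForm θ Z.1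
            - nullForm θ (complexJ p Y).1 * nullForm θ (complexJ p Z).1) := by ring
      _ ≤ _ := this
      _ = (2 * π)⁻¹ * (φ (Circle.exp θ) - a (Circle.exp θ)) * (hnorm Y * hnorm Z) *
          ((nullForm θ p.1)⁻¹ ^ 4 * nullForm θ p.1 ^ 2) := by ring
      _ = _ := by rw [e]; ring

/-- `J` commutes with the connection, and `J² = -1` supplies the minus sign. -/
theorem dbar_complexJ_grad {u : H2 → ℝ} (hu : IsSmooth u) (p : H2) (Y : tangent p) :
    dbar (fun q => complexJ q (grad u q)) p Y
      = (1 / 2 : ℝ) • (complexJ p (hess u p Y) - hess u p (complexJ p Y)) := by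
  have hd := differentiableAt_radialExt_grad hu (fun q => (radialExt_coe u q).symm) p
  simp only [dbar, LinearMap.smul_apply, LinearMap.add_apply, LinearMap.comp_apply,
    nabla_complexJ (grad u) p hd, complexJ_complexJ]
  rfl

theorem hnorm_dbar_le {φ : Circle → ℝ} (hφ : Continuous φ) {a : ℂ →ᵃ[ℝ] ℝ}
    (ha : ∀ w : Circle, a w ≤ φ w) (p : H2) (Y : tangent p) :
    hnorm (dbar (fun q => complexJ q (grad (potential φ) q)) p Y)
      ≤ 3 * (potential φ p - p.1 0 * a (klein p)) * hnorm Y := by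
  set W := dbar (fun q => complexJ q (grad (potential φ) q)) p Y with hW
  have hnn : 0 ≤ potential φ p - p.1 0 * a (klein p) :=
    sub_nonneg.2 (le_potential_of_affine hφ ha p)
  have hJ : complexJ p (-complexJ p W) = W := by rw [map_neg, complexJ_complexJ, neg_neg]
  -- With `Z = -JW` one has `JZ = W` and `⟨Hess Y, Z⟩ = ⟨J Hess Y, W⟩`, so the left side becomes
  -- `2|W|²`. Dividing by `2|W|` turns the constant 6 into 3.
  have h := mink_hess_sub_hess_complexJ_le hφ ha p Y (-complexJ p W)
  have hn : hnorm (-complexJ p W) = hnorm W := by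
    rw [← hnorm_complexJ, hJ]
  rw [hJ, hn, ← mink_complexJ_complexJ, hJ] at h
  have hWW : mink W.1 W.1 = (1 / 2) * (mink (complexJ p (hess (potential φ) p Y)).1 W.1
      - mink (hess (potential φ) p (complexJ p Y)).1 W.1) := by
    have e : W.1 = (1 / 2 : ℝ) • ((complexJ p (hess (potential φ) p Y)).1
        + (-1 : ℝ) • (hess (potential φ) p (complexJ p Y)).1) := by
      rw [hW, dbar_complexJ_grad (isSmooth_potential hφ)]
      simp [sub_eq_add_neg]
    conv_lhs => enter [1]; rw [e]
    rw [mink_smul_left, mink_add_left, mink_smul_left]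
    ring
  rw [← hnorm_sq] at hWW
  rcases (hnorm_nonneg W).eq_or_lt with h0 | h0
  · rw [← h0]
    have := hnorm_nonneg Y
    positivity
  · refine le_of_mul_le_mul_right ?_ h0
    nlinarith

/-! ### From affine minorants to the local width -/

theorem nonempty_affine_le {φ : Circle → ℝ} (hφ : Continuous φ) (η : ℂ) :
    {t : ℝ | ∃ a : ℂ →ᵃ[ℝ] ℝ, (∀ z : Circle, a (z : ℂ) ≤ φ z) ∧ t = a η}.Nonempty := by
  obtain ⟨a, ha, -⟩ := exists_affine_le hφ 1 one_pos
  exact ⟨_, a, ha, rfl⟩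

theorem nonempty_affine_ge {φ : Circle → ℝ} (hφ : Continuous φ) (η : ℂ) :
    {t : ℝ | ∃ a : ℂ →ᵃ[ℝ] ℝ, (∀ z : Circle, φ z ≤ a (z : ℂ)) ∧ t = a η}.Nonempty := by
  obtain ⟨a, ha, -⟩ := exists_affine_ge hφ 1 one_pos
  exact ⟨_, a, ha, rfl⟩

/-- Since `w = p₀ (φ⁺ - φ⁻)` at `Π p`, it suffices that `u(p) ≤ p₀ φ⁺`, and that the bounds over all
minorants `a` pass to the supremum `φ⁻`. -/
theorem le_localWidth {X : Circle → ℂ} (hc : Continuous (supportFn X)) (p : H2) {r : ℝ}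
    (hr : ∀ a : ℂ →ᵃ[ℝ] ℝ, (∀ w : Circle, a w ≤ supportFn X w) →
      r ≤ potential (supportFn X) p - p.1 0 * a (klein p)) :
    r ≤ localWidth X (klein p) := by
  have h0 := p.2.2
  have h1 : potential (supportFn X) p / p.1 0 ≤ upperHull (supportFn X) (klein p) := by
    refine le_csInf (nonempty_affine_ge hc _) ?_
    rintro _ ⟨b, hb, rfl⟩
    rw [div_le_iff₀' h0]
    exact potential_le_of_affine hc hb p
  have h2 : lowerHull (supportFn X) (klein p) ≤ (potential (supportFn X) p - r) / p.1 0 := by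
    refine csSup_le (nonempty_affine_le hc _) ?_
    rintro _ ⟨a, ha, rfl⟩
    rw [le_div_iff₀' h0]
    linarith [hr a ha]
  rw [localWidth, sqrt_one_sub_norm_klein, div_inv_eq_mul]
  rw [div_le_iff₀ h0] at h1
  rw [le_div_iff₀ h0] at h2
  linarith

theorem continuous_supportFn {X : Circle → ℂ} (hc : Continuous X) : Continuous (supportFn X) := by
  have : Continuous fun z : Circle => Complex.I * (z : ℂ) :=
    continuous_const.mul continuous_subtype_val
  exact this.inner hc

theorem hnorm_pos {p : H2} {Y : tangent p} (hY : Y ≠ 0) : 0 < hnorm Y := by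
  refine (hnorm_nonneg Y).lt_of_ne fun h => hY ?_
  have h1 : mink Y.1 Y.1 = 0 := by rw [← hnorm_sq, ← h]; norm_num
  have h2 := mink_eq_frame Y.1 Y
  rw [h1, mink_comm (frameFst p).1, mink_comm (frameSnd p).1] at h2
  have h3 : mink Y.1 (frameFst p).1 = 0 := by nlinarith [mul_self_nonneg (mink Y.1 (frameFst p).1), mul_self_nonneg (mink Y.1 (frameSnd p).1)]
  have h4 : mink Y.1 (frameSnd p).1 = 0 := by nlinarith [mul_self_nonneg (mink Y.1 (frameFst p).1), mul_self_nonneg (mink Y.1 (frameSnd p).1)]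
  rw [← frame_expansion Y, h3, h4]
  simp

theorem tensorNorm_dbar_HL_le {X : Circle → ℂ} (hc : Continuous (supportFn X)) (p : H2) :
    tensorNorm (dbar (HL X) p) ≤ 3 * localWidth X (klein p) := by
  have hHL : HL X = fun q => complexJ q (grad (potential (supportFn X)) q) := by
    funext q
    rw [HL, meanFn_eq_potential hc]
  have h0 : 0 ≤ localWidth X (klein p) :=
    le_localWidth hc p fun a ha => sub_nonneg.2 (le_potential_of_affine hc ha p)
  -- `Real.sSup_le` also asks for a nonnegative bound, since the supremum of the empty set is 0 by
  -- convention.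
  refine Real.sSup_le ?_ (by positivity)
  rintro _ ⟨Y, hY, rfl⟩
  have hpos := hnorm_pos hY
  rw [hHL]
  have : hnorm (dbar (fun q => complexJ q (grad (potential (supportFn X)) q)) p Y) / hnorm Y / 3
      ≤ localWidth X (klein p) := by
    refine le_localWidth hc p fun a ha => ?_
    rw [div_le_iff₀ (by norm_num), div_le_iff₀ hpos]
    linarith [hnorm_dbar_le hc ha p Y]
  linarith

end HalfPipe

end

theorem proposition7p1 (X : Circle → ℂ) (hX : HalfPipe.IsCircleField X) (hc : Continuous X) :
    (∃! u : HalfPipe.H2 → ℝ, HalfPipe.IsMeanSurface (HalfPipe.supportFn X) u) ∧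
      ∀ p : HalfPipe.H2,
        HalfPipe.tensorNorm (HalfPipe.dbar (HalfPipe.HL X) p) ≤
          6 * HalfPipe.localWidth X (HalfPipe.klein p) := by
  have hφ := HalfPipe.continuous_supportFn hc
  refine ⟨⟨_, HalfPipe.isMeanSurface_potential hφ,
    fun u hu => hu.eq (HalfPipe.isMeanSurface_potential hφ)⟩, fun p => ?_⟩
  have h := HalfPipe.tensorNorm_dbar_HL_le hφ p
  -- Nonnegativity of the width weakens the constant 3 to 6.
  have h0 : 0 ≤ HalfPipe.localWidth X (HalfPipe.klein p) :=
    HalfPipe.le_localWidth hφ p fun a ha =>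
      sub_nonneg.2 (HalfPipe.le_potential_of_affine hφ ha p)
  linarith
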